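/- **Setting.** Fix a homeomorphism $\hbar:\mathbb R\to(0,1)$ (for example $\hbar(x)=\frac1\pi(\frac\pi2+\arctan x)$). For $\sigma$ in the group $\mathrm{Homeo}_+(\mathbb R)$ of increasing homeomorphisms of $\mathbb R$, let $\hbar(\sigma)\in\mathrm{Homeo}_+(\mathbb R)$ be the map that fixes every integer and equals $x\mapsto \hbar\sigma\hbar^{-1}(x-i)+i$ on $(i,i+1)$, $i\in\mathbb Z$. Write $L_a(x)=x+a$. For an irrational $\alpha\in(0,1)$ let $G_{\alpha,2}=\langle L_1,L_\alpha\rangle$ and, for $n\ge2$, $G_{\alpha,n+1}=\langle \{\hbar(\sigma):\sigma\in G_{\alpha,n}\}\cup\{L_1\}\rangle$. For $s\ge1$ put $G_{\alpha,n}^s=\{h^s:h\in G_{\alpha,n}\}$. For an integer $k\ge1$ put $x_j=e^{2\pi \mathrm i j/k}$ ($j\in\mathbb Z$, so that $x_{j+k}=x_j$), let $(x_j,x_{j+1})$ be the open arc of the unit circle $\mathbb S^1$ from $x_j$ to $x_{j+1}$ anticlockwise (the circle minus the point $1$ if $k=1$), and fix an orientation preserving homeomorphism $\phi=\phi_k:\mathbb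 R\to(x_1,x_2)$. Let $n\ge2$, let $g\in G_{\alpha,n}\setminus\bigcup_{s\ge1,\ \gcd(k,s)\ne1}G_{\alpha,n}^s$, and let $\mathrm{Homeo}_+(\mathbb S^1)_{k,g}$ be the set of all orientation preserving homeomorphisms $f$ of $\mathbb S^1$ with $f(x_j)=x_{j+1}$ for all $j$ and $f^k=\phi g\phi^{-1}$ on $(x_1,x_2)$. For $f$ in this set and $\sigma\in\mathrm{Homeo}_+(\mathbb R)$, let $\overline\sigma^f\in\mathrm{Homeo}_+(\mathbb S^1)$ fix every $x_j$ and equal $f^{i-1}\phi\sigma\phi^{-1}f^{-(i-1)}$ on $(x_i,x_{i+1})$ for $i=1,\dots,k$. Define $G_{\alpha,n,k,g,f}=\langle\{\overline\sigma^f:\sigma\in G_{\alpha,n}\}\cup\{f\}\rangle\le\mathrm{Homeo}_+(\mathbb S^1)$. Two subgroups $G,H$ of $\mathrm{Homeo}_+(\mathbb S^1)$ are *topologically conjugate* if $\Psi G\Psi^{-1}=H$ for some $\Psi\in\mathrm{Homeo}_+(\mathbb S^1)$. Irrationals $\alpha,\alpha'\in(0,1)$ are *equivalent* if $\alpha'=\frac{m_1+n_1\alpha}{m_2+n_2\alpha}$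 for some $m_1,n_1,m_2,n_2\in\mathbb Z$ with $|m_1n_2-n_1m_2|=1$. Let $\mathrm{Conj}(G_{\alpha,n},G_{\alpha',n})=\{\psi\in\mathrm{Homeo}_+(\mathbb R):G_{\alpha,n}=\psi G_{\alpha',n}\psi^{-1}\}$ and $N(G_{\alpha,n})=\{\varphi\in\mathrm{Homeo}_+(\mathbb R):\varphi G_{\alpha,n}\varphi^{-1}=G_{\alpha,n}\}$. The group $N(G_{\alpha,n})\ltimes G_{\alpha,n}^k$ acts on $G_{\alpha,n}$ by the affine action $(\varphi,u).g=\varphi g\varphi^{-1}u$. **Theorem.** Let $G_{\alpha,n,k,g,f}$ and $G_{\alpha',n',k',g',f'}$ be two groups as above (built with the same $\hbar$ and the same maps $\phi_k$). If $\alpha$ and $\alpha'$ are equivalent, then $\mathrm{Conj}(G_{\alpha,n},G_{\alpha',n})\neq\emptyset$. Whenever $n=n'$ and $\alpha,\alpha'$ are equivalent, fix any $\psi_{\alpha,\alpha'}\in\mathrm{Conj}(G_{\alpha,n},G_{\alpha',n})$. Then $G_{\alpha,n,k,g,f}$ is topologically conjugate to $G_{\alpha',n',k',g',f'}$ if and only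 if 1. $n=n'$ and $k=k'$; 2. $\alpha$ is equivalent to $\alpha'$; 3. $g$ and $\psi_{\alpha,\alpha'}\,g'\,\psi_{\alpha,\alpha'}^{-1}$ lie in the same orbit of the affine action of $N(G_{\alpha,n})\ltimes G_{\alpha,n}^k$ on $G_{\alpha,n}$, i.e. $\psi_{\alpha,\alpha'}g'\psi_{\alpha,\alpha'}^{-1}=\varphi g\varphi^{-1}h^k$ for some $\varphi\in N(G_{\alpha,n})$ and $h\in G_{\alpha,n}$. In particular the conjugacy class does not depend on $f$: for all $f,f_1\in\mathrm{Homeo}_+(\mathbb S^1)_{k,g}$ the groups $G_{\alpha,n,k,g,f}$ and $G_{\alpha,n,k,g,f_1}$ are topologically conjugate. -/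

import Mathlib

namespace CircleZn

open Set

/-- `Homeo₊(ℝ)`, the group of increasing homeomorphisms of the line under composition. An order
automorphism of `ℝ` is the same thing as an increasing homeomorphism. -/
abbrev HomeoPlusReal : Type := ℝ ≃o ℝ

/-- Every strictly increasing homeomorphism of the line is an element of `HomeoPlusReal`, and every
element of `HomeoPlusReal` is a strictly increasing homeomorphism. -/
theorem homeoPlusReal_spec (u : ℝ → ℝ) :
    (∃ h : ℝ ≃ₜ ℝ, StrictMono h ∧ ⇑h = u) ↔ ∃ σ : HomeoPlusReal, ⇑σ = u := by
  constructor
  · rintro ⟨h, hm, rfl⟩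
    exact ⟨StrictMono.orderIsoOfSurjective h hm h.surjective, rfl⟩
  · rintro ⟨σ, rfl⟩
    exact ⟨σ.toHomeomorph, σ.strictMono, rfl⟩

/-- The translation `L_a : x ↦ x + a`. -/
def L (a : ℝ) : HomeoPlusReal := OrderIso.addRight a

section Glue

theorem fract_mem {x : ℝ} (h : Int.fract x ≠ 0) : Int.fract x ∈ Ioo (0 : ℝ) 1 :=
  ⟨lt_of_le_of_ne (Int.fract_nonneg x) (Ne.symm h), Int.fract_lt_one x⟩

open Classical in
/-- Fix the integers, and act on `(i, i + 1)` by the `i`-th member of a family of automorphisms of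
`(0, 1)`, moved to `(i, i + 1)` by a translation. -/
noncomputable def glueFun (e : ℤ → (Ioo (0 : ℝ) 1 ≃o Ioo (0 : ℝ) 1)) (x : ℝ) : ℝ :=
  if h : Int.fract x = 0 then x else (e ⌊x⌋ ⟨Int.fract x, fract_mem h⟩ : ℝ) + ⌊x⌋

theorem glueFun_int (e : ℤ → (Ioo (0 : ℝ) 1 ≃o Ioo (0 : ℝ) 1)) (i : ℤ) :
    glueFun e i = i := by
  simp [glueFun]

theorem glueFun_cell (e : ℤ → (Ioo (0 : ℝ) 1 ≃o Ioo (0 : ℝ) 1)) (i : ℤ) (y : Ioo (0 : ℝ) 1) :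
    glueFun e (y + i) = e i y + i := by
  have hf : ⌊(y : ℝ) + i⌋ = i := by
    rw [Int.floor_add_intCast, Int.floor_eq_zero_iff.2 ⟨y.2.1.le, y.2.2⟩, zero_add]
  have hr : Int.fract ((y : ℝ) + i) = y := by
    rw [Int.fract, hf]; ring
  have h0 : Int.fract ((y : ℝ) + i) ≠ 0 := by rw [hr]; exact y.2.1.ne'
  have hy : (⟨Int.fract ((y : ℝ) + i), fract_mem h0⟩ : Ioo (0 : ℝ) 1) = y := Subtype.ext hr
  rw [glueFun, dif_neg h0, hy, hf]

theorem int_or_cell (x : ℝ) : (∃ i : ℤ, x = i) ∨ ∃ (i : ℤ) (y : Ioo (0 : ℝ) 1), x = y + i := by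
  by_cases h : Int.fract x = 0
  · exact Or.inl ⟨⌊x⌋, by have := Int.floor_add_fract x; rw [h] at this; linarith⟩
  · exact Or.inr ⟨⌊x⌋, ⟨_, fract_mem h⟩, (Int.fract_add_floor x).symm⟩

theorem glueFun_leftInverse (e : ℤ → (Ioo (0 : ℝ) 1 ≃o Ioo (0 : ℝ) 1)) (x : ℝ) :
    glueFun (fun i => (e i).symm) (glueFun e x) = x := by
  rcases int_or_cell x with ⟨i, rfl⟩ | ⟨i, y, rfl⟩
  · rw [glueFun_int, glueFun_int]
  · rw [glueFun_cell, glueFun_cell, OrderIso.symm_apply_apply]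

theorem glueFun_strictMono (e : ℤ → (Ioo (0 : ℝ) 1 ≃o Ioo (0 : ℝ) 1)) :
    StrictMono (glueFun e) := by
  intro a b hab
  have key : ∀ (i j : ℤ) (u : ℝ), 0 ≤ u → u < j - i → (j : ℝ) - i ≥ 1 := by
    intro i j u hu h
    have : i < j := by exact_mod_cast (by linarith : (i : ℝ) < j)
    have : i + 1 ≤ j := this
    have : (i : ℝ) + 1 ≤ j := by exact_mod_cast this
    linarith
  rcases int_or_cell a with ⟨i, rfl⟩ | ⟨i, y, rfl⟩ <;>
    rcases int_or_cell b with ⟨j, rfl⟩ | ⟨j, z, rfl⟩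
  · rwa [glueFun_int, glueFun_int]
  · rw [glueFun_int, glueFun_cell]
    have h1 : i ≤ j := by
      by_contra hc
      have : j + 1 ≤ i := by omega
      have : (j : ℝ) + 1 ≤ i := by exact_mod_cast this
      linarith [z.2.2]
    have : (i : ℝ) ≤ j := by exact_mod_cast h1
    linarith [(e j z).2.1]
  · rw [glueFun_int, glueFun_cell]
    have := key i j y y.2.1.le (by linarith)
    linarith [(e i y).2.2]
  · rw [glueFun_cell, glueFun_cell]
    rcases lt_trichotomy i j with h | h | h
    · have : (i : ℝ) + 1 ≤ j := by exact_mod_cast h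
      linarith [(e i y).2.2, (e j z).2.1]
    · subst h
      have h1 : y < z := by
        rw [← Subtype.coe_lt_coe]; linarith
      have h2 : e i y < e i z := (e i).lt_iff_lt.2 h1
      rw [← Subtype.coe_lt_coe] at h2
      linarith
    · have : (j : ℝ) + 1 ≤ i := by exact_mod_cast h
      linarith [y.2.1, z.2.2]

/-- `glueFun` as an increasing homeomorphism of the line. -/
noncomputable def glue (e : ℤ → (Ioo (0 : ℝ) 1 ≃o Ioo (0 : ℝ) 1)) : HomeoPlusReal where
  toFun := glueFun e
  invFun := glueFun fun i => (e i).symm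
  left_inv := glueFun_leftInverse e
  right_inv := glueFun_leftInverse fun i => (e i).symm
  map_rel_iff' := (glueFun_strictMono e).le_iff_le

end Glue

section Line

/-- For a homeomorphism `ℏ : ℝ → (0, 1)` and `σ ∈ Homeo₊(ℝ)`, the increasing bijection
`ℏ σ ℏ⁻¹` of `(0, 1)`. -/
noncomputable def conjIoo (ℏ : ℝ ≃ₜ Ioo (0 : ℝ) 1) (σ : HomeoPlusReal) :
    Ioo (0 : ℝ) 1 ≃o Ioo (0 : ℝ) 1 where
  toEquiv := (ℏ.symm.toEquiv.trans σ.toEquiv).trans ℏ.toEquiv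
  map_rel_iff' := by
    intro a b
    change ℏ (σ (ℏ.symm a)) ≤ ℏ (σ (ℏ.symm b)) ↔ a ≤ b
    have hc : Continuous fun t : ℝ => (ℏ t : ℝ) := continuous_subtype_val.comp ℏ.continuous
    have hi : Function.Injective fun t : ℝ => (ℏ t : ℝ) :=
      Subtype.val_injective.comp ℏ.injective
    rcases hc.strictMono_of_inj hi with h | h
    · have h' : ∀ s t, ℏ s ≤ ℏ t ↔ s ≤ t := fun s t => h.le_iff_le
      rw [h', OrderIso.le_iff_le, ← h', ℏ.apply_symm_apply, ℏ.apply_symm_apply]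
    · have h' : ∀ s t, ℏ s ≤ ℏ t ↔ t ≤ s := fun s t => h.le_iff_ge
      rw [h', OrderIso.le_iff_le, ← h', ℏ.apply_symm_apply, ℏ.apply_symm_apply]

/-- The map `σ ↦ ℏ(σ)` on `Homeo₊(ℝ)`: the homeomorphism `ℏ(σ)` fixes every integer, and is
`x ↦ ℏ σ ℏ⁻¹ (x - i) + i` on `(i, i + 1)`. -/
noncomputable def hbar (ℏ : ℝ ≃ₜ Ioo (0 : ℝ) 1) (σ : HomeoPlusReal) : HomeoPlusReal :=
  glue fun _ => conjIoo ℏ σ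

theorem hbar_int (ℏ : ℝ ≃ₜ Ioo (0 : ℝ) 1) (σ : HomeoPlusReal) (i : ℤ) : hbar ℏ σ i = i :=
  glueFun_int (fun _ => conjIoo ℏ σ) i

theorem hbar_cell (ℏ : ℝ ≃ₜ Ioo (0 : ℝ) 1) (σ : HomeoPlusReal) (i : ℤ) (y : Ioo (0 : ℝ) 1) :
    hbar ℏ σ (y + i) = ℏ (σ (ℏ.symm y)) + i :=
  glueFun_cell (fun _ => conjIoo ℏ σ) i y

/-- The groups `G_{α,n}` for `n ≥ 2`: `G_{α,2}` is generated by `L_1` and `L_α`, and `G_{α,n+1}`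
by `L_1` and all `ℏ(σ)` with `σ ∈ G_{α,n}`. (The values at `n = 0, 1` play no role.) -/
noncomputable def lineGroup (ℏ : ℝ ≃ₜ Ioo (0 : ℝ) 1) (α : ℝ) : ℕ → Subgroup HomeoPlusReal
  | 0 => ⊥
  | 1 => ⊥
  | 2 => Subgroup.closure {L 1, L α}
  | n + 3 => Subgroup.closure (hbar ℏ '' (lineGroup ℏ α (n + 2) : Set HomeoPlusReal) ∪ {L 1})

/-- `G^s = {h ^ s : h ∈ G}`. -/
def powers (G : Subgroup HomeoPlusReal) (s : ℕ) : Set HomeoPlusReal :=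
  {q | ∃ h ∈ G, q = h ^ s}

/-- The admissible parameters `g`: the elements of `G` which are not in `G^s` for any `s ≥ 1` with
`gcd(k, s) ≠ 1`. -/
def admissible (G : Subgroup HomeoPlusReal) (k : ℕ) : Set HomeoPlusReal :=
  {g | g ∈ G ∧ ∀ s : ℕ, 1 ≤ s → Nat.gcd k s ≠ 1 → g ∉ powers G s}

/-- `Conj(G, G') = {ψ ∈ Homeo₊(ℝ) : G = ψ G' ψ⁻¹}`. -/
def conjugators (G G' : Subgroup HomeoPlusReal) : Set HomeoPlusReal :=
  {ψ | G = G'.map (MulAut.conj ψ).toMonoidHom}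

/-- The normalizer `{φ ∈ Homeo₊(ℝ) : φ G φ⁻¹ = G}`. -/
def lineNormalizer (G : Subgroup HomeoPlusReal) : Set HomeoPlusReal :=
  {φ | G.map (MulAut.conj φ).toMonoidHom = G}

/-- The orbit of `g` under the affine action `(φ, f) . g = φ g φ⁻¹ f` of the semidirect product of
the normalizer of `G` with `G^k`. -/
def affineOrbit (G : Subgroup HomeoPlusReal) (k : ℕ) (g : HomeoPlusReal) : Set HomeoPlusReal :=
  {q | ∃ φ ∈ lineNormalizer G, ∃ f ∈ powers G k, q = φ * g * φ⁻¹ * f}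

/-- Equivalence of irrational numbers under Möbius transformations in `GL(2, ℤ)`. -/
def MobiusEquiv (α β : ℝ) : Prop :=
  ∃ m₁ n₁ m₂ n₂ : ℤ, |m₁ * n₂ - n₁ * m₂| = 1 ∧ β = (m₁ + n₁ * α) / (m₂ + n₂ * α)

end Line

section CircleHomeo

/-- A homeomorphism of the unit circle preserves the orientation if it lifts to an increasing
homeomorphism of the line along `t ↦ exp(it)`. -/
def OrientationPreserving (f : Circle ≃ₜ Circle) : Prop :=
  ∃ F : ℝ ≃o ℝ, ∀ t : ℝ, f (Circle.exp t) = Circle.exp (F t)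

/-- `Homeo₊(S¹)`. -/
noncomputable def HomeoPlusCircle : Subgroup (Circle ≃ₜ Circle) where
  carrier := {f | OrientationPreserving f}
  one_mem' := ⟨OrderIso.refl ℝ, fun _ => rfl⟩
  mul_mem' := by
    rintro f g ⟨F, hF⟩ ⟨G, hG⟩
    exact ⟨G.trans F, fun t => by
      change f (g (Circle.exp t)) = Circle.exp (F (G t)); rw [hG, hF]⟩
  inv_mem' := by
    rintro f ⟨F, hF⟩
    refine ⟨F.symm, fun t => ?_⟩
    change f.symm (Circle.exp t) = _
    rw [Homeomorph.symm_apply_eq, hF, OrderIso.apply_symm_apply]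

/-- Topological conjugacy of two subgroups of `Homeo₊(S¹)`: `Ψ G Ψ⁻¹ = H` for some
`Ψ ∈ Homeo₊(S¹)`. -/
def TopConj (G H : Subgroup HomeoPlusCircle) : Prop :=
  ∃ Ψ : HomeoPlusCircle, G.map (MulAut.conj Ψ).toMonoidHom = H

/-- The point `exp(2πi x / k)` of the unit circle. -/
noncomputable def circlePoint (k : ℕ) (x : ℝ) : Circle := Circle.exp (2 * Real.pi * x / k)

/-- The points `x_j = exp(2πi j / k)`; they depend only on `j` modulo `k`. -/
noncomputable def vertex (k : ℕ) (j : ℤ) : Circle := circlePoint k j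

/-- The orientation preserving homeomorphism from `ℝ` onto the anticlockwise open arc
`(x_1, x_2) = {exp(2πi (1 + s) / k) : 0 < s < 1}` which corresponds to the increasing homeomorphism
`Φ` from `ℝ` onto `(0, 1)`. As `s ↦ exp(2πi (1 + s) / k)` is an orientation preserving homeomorphism
from `(0, 1)` onto this arc, every orientation preserving homeomorphism from `ℝ` onto
the arc arises from exactly one `Φ`. -/
noncomputable def arcMap (k : ℕ) (Φ : ℝ ≃o Ioo (0 : ℝ) 1) (t : ℝ) : Circle :=
  circlePoint k (1 + Φ t)

/-- The set of the `f ∈ Homeo₊(S¹)` with `f(x_j) = x_{j+1}` for all `j` whose `k`-th power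
is `φ g φ⁻¹` on the arc `(x_1, x_2)`, where `φ = arcMap k Φ`. -/
def rootSet (k : ℕ) (Φ : ℝ ≃o Ioo (0 : ℝ) 1) (g : HomeoPlusReal) : Set HomeoPlusCircle :=
  {f | (∀ j : ℤ, f.1 (vertex k j) = vertex k (j + 1)) ∧
    ∀ t : ℝ, (f ^ k).1 (arcMap k Φ t) = arcMap k Φ (g t)}

/-- `τ` is the extension of `σ` to the circle along `f`: it fixes every `x_j`, and it is
`f^i φ σ φ⁻¹ f^{-i}` on the arc `(x_{i+1}, x_{i+2}) = f^i (x_1, x_2)` for `i = 0, …, k - 1`,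
where `φ = arcMap k Φ`. -/
def IsExtension (k : ℕ) (Φ : ℝ ≃o Ioo (0 : ℝ) 1) (f : HomeoPlusCircle) (σ : HomeoPlusReal)
    (τ : HomeoPlusCircle) : Prop :=
  (∀ j : ℤ, τ.1 (vertex k j) = vertex k j) ∧
    ∀ i : ℕ, i < k → ∀ t : ℝ, τ.1 ((f ^ i).1 (arcMap k Φ t)) = (f ^ i).1 (arcMap k Φ (σ t))

/-- The group `G_{α,n,k,g,f}`: the subgroup of `Homeo₊(S¹)` generated by `f` and by the extensions
along `f` of the elements of `G = G_{α,n}`. (The parameter `g` enters through `f ∈ rootSet k Φ g`.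
Every `σ` has exactly one extension along `f`, as is proved below.) -/
noncomputable def circleGroup (G : Subgroup HomeoPlusReal) (k : ℕ) (Φ : ℝ ≃o Ioo (0 : ℝ) 1)
    (f : HomeoPlusCircle) : Subgroup HomeoPlusCircle :=
  Subgroup.closure ({τ | ∃ σ ∈ G, IsExtension k Φ f σ τ} ∪ {f})

end CircleHomeo

section Extension

theorem circlePoint_eq_iff {k : ℕ} (hk : 1 ≤ k) (x y : ℝ) :
    circlePoint k x = circlePoint k y ↔ ∃ m : ℤ, x = y + m * k := by
  have hk0 : (k : ℝ) ≠ 0 := by positivity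
  have hpi := Real.pi_ne_zero
  rw [circlePoint, circlePoint, Circle.exp_eq_exp]
  refine exists_congr fun m => ?_
  constructor
  · intro h
    field_simp at h
    linarith
  · rintro rfl
    field_simp

theorem circlePoint_surjective {k : ℕ} (hk : 1 ≤ k) (z : Circle) : ∃ x, circlePoint k x = z := by
  have hk0 : (k : ℝ) ≠ 0 := by positivity
  have hpi := Real.pi_ne_zero
  obtain ⟨t, rfl⟩ := Circle.exp_surjective z
  refine ⟨t * k / (2 * Real.pi), ?_⟩
  rw [circlePoint]
  congr 1
  field_simp

/-- Rescaled lifts. -/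
theorem exists_lift {k : ℕ} (hk : 1 ≤ k) (f : HomeoPlusCircle) :
    ∃ F : ℝ ≃o ℝ, ∀ x, f.1 (circlePoint k x) = circlePoint k (F x) := by
  obtain ⟨F, hF⟩ := f.2
  have hc : 0 < 2 * Real.pi / k := by positivity
  have hk0 : (k : ℝ) ≠ 0 := by positivity
  have hpi := Real.pi_ne_zero
  let s : ℝ ≃o ℝ := OrderIso.mulLeft₀ (2 * Real.pi / k) hc
  refine ⟨(s.trans F).trans s.symm, fun x => ?_⟩
  have h1 : ∀ y, circlePoint k y = Circle.exp (s y) := by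
    intro y
    change Circle.exp _ = Circle.exp (2 * Real.pi / k * y)
    congr 1
    ring
  rw [h1, h1, hF]
  change _ = Circle.exp (s (s.symm (F (s x))))
  rw [OrderIso.apply_symm_apply]

/-- A periodic increasing homeomorphism of the line descends to the circle. -/
theorem exists_descent {k : ℕ} (hk : 1 ≤ k) (S : ℝ ≃o ℝ) (hS : ∀ x, S (x + k) = S x + k) :
    ∃ τ : HomeoPlusCircle, ∀ x, τ.1 (circlePoint k x) = circlePoint k (S x) := by
  have hk0 : (k : ℝ) ≠ 0 := by positivity
  have hc : 0 < 2 * Real.pi / k := by positivity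
  have hpi := Real.pi_ne_zero
  let s : ℝ ≃o ℝ := OrderIso.mulLeft₀ (2 * Real.pi / k) hc
  have h1 : ∀ y, circlePoint k y = Circle.exp (s y) := by
    intro y
    change Circle.exp _ = Circle.exp (2 * Real.pi / k * y)
    congr 1
    ring
  have hper : ∀ T : ℝ ≃o ℝ, (∀ x, T (x + k) = T x + k) →
      ∀ (m : ℤ) x, T (x + m * k) = T x + m * k := by
    intro T hT m
    induction m using Int.induction_on with
    | zero => intro x; simp
    | succ i ih =>
      intro x
      have := hT (x + (i : ℤ) * k)
      rw [ih] at this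
      push_cast at this ⊢
      rw [show x + ((i : ℝ) + 1) * k = x + i * k + k by ring, this]
      ring
    | pred i ih =>
      intro x
      have := hT (x + ((-i - 1 : ℤ) : ℝ) * k)
      have h2 := ih x
      push_cast at this h2 ⊢
      rw [show x + (-(i : ℝ) - 1) * k + k = x + -(i : ℝ) * k by ring, h2] at this
      linarith
  have hS' : ∀ x, S.symm (x + k) = S.symm x + k := by
    intro x
    rw [OrderIso.symm_apply_eq, hS, OrderIso.apply_symm_apply]
  have hfun : ∀ T : ℝ ≃o ℝ, (∀ x, T (x + k) = T x + k) →
      ∃ u : Circle → Circle, Continuous u ∧ ∀ x, u (circlePoint k x) = circlePoint k (T x) := by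
    intro T hT
    have hu : ∀ z : Circle, ∃ w : Circle, ∀ x, circlePoint k x = z → w = circlePoint k (T x) := by
      intro z
      obtain ⟨y, rfl⟩ := circlePoint_surjective hk z
      refine ⟨circlePoint k (T y), fun x hx => ?_⟩
      obtain ⟨m, rfl⟩ := (circlePoint_eq_iff hk x y).1 hx
      rw [circlePoint_eq_iff hk, hper T hT]
      exact ⟨-m, by push_cast; ring⟩
    choose u hu using hu
    have hu' : ∀ x, u (circlePoint k x) = circlePoint k (T x) := fun x => hu _ x rfl
    refine ⟨u, ?_, hu'⟩
    have hq : Topology.IsQuotientMap (Circle.exp : ℝ → Circle) :=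
      isLocalHomeomorph_circleExp.isOpenMap.isQuotientMap Circle.exp.continuous
        Circle.exp_surjective
    rw [hq.continuous_iff]
    have : u ∘ Circle.exp = fun t => Circle.exp (s (T (s.symm t))) := by
      funext t
      rw [← h1, ← hu', h1, OrderIso.apply_symm_apply]
      rfl
    rw [this]
    exact Circle.exp.continuous.comp
      (s.continuous.comp (T.continuous.comp s.symm.continuous))
  obtain ⟨u, huc, hu⟩ := hfun S hS
  obtain ⟨v, hvc, hv⟩ := hfun S.symm hS'
  refine ⟨⟨⟨⟨u, v, ?_, ?_⟩, huc, hvc⟩, ?_⟩, hu⟩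
  · intro z
    obtain ⟨x, rfl⟩ := circlePoint_surjective hk z
    rw [hu, hv, OrderIso.symm_apply_apply]
  · intro z
    obtain ⟨x, rfl⟩ := circlePoint_surjective hk z
    rw [hv, hu, OrderIso.apply_symm_apply]
  · refine ⟨(s.symm.trans S).trans s, fun t => ?_⟩
    change u (Circle.exp t) = Circle.exp (s (S (s.symm t)))
    rw [← h1, ← hu, h1, OrderIso.apply_symm_apply]

/-- The restriction to `(0, 1)` of an increasing homeomorphism of the line fixing `0` and `1`. -/
def restrictIoo (B : ℝ ≃o ℝ) (h0 : B 0 = 0) (h1 : B 1 = 1) :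
    Ioo (0 : ℝ) 1 ≃o Ioo (0 : ℝ) 1 where
  toFun y := ⟨B y, h0.symm.trans_lt (B.lt_iff_lt.2 y.2.1), (B.lt_iff_lt.2 y.2.2).trans_eq h1⟩
  invFun y := ⟨B.symm y, by rw [B.lt_symm_apply, h0]; exact y.2.1,
    by rw [B.symm_apply_lt, h1]; exact y.2.2⟩
  left_inv y := Subtype.ext (B.symm_apply_apply _)
  right_inv y := Subtype.ext (B.apply_symm_apply _)
  map_rel_iff' {_ _} := B.le_iff_le

/-- A lift which moves every integer to the next one. -/
theorem exists_shift_lift {k : ℕ} (hk : 1 ≤ k) (f : HomeoPlusCircle)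
    (hf : ∀ j : ℤ, f.1 (vertex k j) = vertex k (j + 1)) :
    ∃ F : ℝ ≃o ℝ, (∀ x, f.1 (circlePoint k x) = circlePoint k (F x)) ∧
      ∀ j : ℤ, F j = j + 1 := by
  obtain ⟨F, hF⟩ := exists_lift hk f
  have hZ : ∀ j : ℤ, ∃ l m : ℤ, F j = l ∧ l = j + 1 + m * k := by
    intro j
    have := hf j
    rw [vertex, vertex, hF, circlePoint_eq_iff hk] at this
    obtain ⟨m, hm⟩ := this
    exact ⟨j + 1 + m * k, m, by rw [hm]; push_cast; ring, rfl⟩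
  have hZ' : ∀ l : ℤ, ∃ j : ℤ, F j = l := by
    intro l
    have h := hf (l - 1)
    rw [vertex, vertex, ← F.apply_symm_apply ((l - 1 + 1 : ℤ) : ℝ), ← hF] at h
    have h' := f.1.injective h
    rw [circlePoint_eq_iff hk] at h'
    obtain ⟨m, hm⟩ := h'
    refine ⟨l - 1 - m * k, ?_⟩
    rw [← OrderIso.eq_symm_apply]
    have : ((l - 1 + 1 : ℤ) : ℝ) = l := by push_cast; ring
    rw [this] at hm
    push_cast at hm ⊢
    linarith
  have hstep : ∀ j : ℤ, F (j + 1 : ℤ) = F j + 1 := by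
    intro j
    obtain ⟨a, -, ha, -⟩ := hZ j
    obtain ⟨b, -, hb, -⟩ := hZ (j + 1)
    have hab : a < b := by
      have : F j < F (j + 1 : ℤ) := F.lt_iff_lt.2 (by push_cast; linarith)
      rw [ha, hb] at this
      exact_mod_cast this
    obtain ⟨c, hc⟩ := hZ' (a + 1)
    have h1 : j < c := by
      have : F j < F c := by rw [ha, hc]; push_cast; linarith
      exact_mod_cast F.lt_iff_lt.1 this
    have h2 : (F (j + 1 : ℤ) : ℝ) ≤ F c := F.le_iff_le.2 (by exact_mod_cast h1)
    rw [hb, hc] at h2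
    have h3 : b ≤ a + 1 := by exact_mod_cast h2
    rw [ha, hb]
    have : b = a + 1 := by omega
    rw [this]; push_cast; ring
  obtain ⟨a, m, ha, ham⟩ := hZ 0
  have hall : ∀ j : ℤ, F j = j + a := by
    intro j
    induction j using Int.induction_on with
    | zero => rw [ha]; simp
    | succ i ih =>
      rw [hstep, ih]; push_cast; ring
    | pred i ih =>
      have := hstep (-i - 1)
      rw [show (-(i : ℤ) - 1 + 1) = -i by ring, ih] at this
      push_cast at this ⊢
      linarith
  refine ⟨F.trans (OrderIso.addRight (-(m * k) : ℝ)), fun x => ?_, fun j => ?_⟩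
  · rw [hF, circlePoint_eq_iff hk]
    exact ⟨m, by simp⟩
  · change F j + -(m * k : ℝ) = j + 1
    rw [hall, ham]
    push_cast
    ring

/-- The extension exists and is unique. -/
theorem existsUnique_extension {k : ℕ} (hk : 1 ≤ k) (Φ : ℝ ≃o Ioo (0 : ℝ) 1) (f : HomeoPlusCircle)
    (hf : ∀ j : ℤ, f.1 (vertex k j) = vertex k (j + 1)) (σ : HomeoPlusReal) :
    ∃! τ : HomeoPlusCircle, IsExtension k Φ f σ τ := by
  obtain ⟨F, hF, hFj⟩ := exists_shift_lift hk f hf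
  have hpow : ∀ (i : ℕ) (x : ℝ), (f ^ i).1 (circlePoint k x) = circlePoint k ((F ^ i) x) := by
    intro i
    induction i with
    | zero => intro x; rfl
    | succ i ih =>
      intro x
      rw [pow_succ, pow_succ]
      change (f ^ i).1 (f.1 (circlePoint k x)) = circlePoint k ((F ^ i) (F x))
      rw [hF, ih]
  have hpowj : ∀ (i : ℕ) (j : ℤ), (F ^ i) (j : ℝ) = j + i := by
    intro i
    induction i with
    | zero => intro j; simp
    | succ i ih =>
      intro j
      rw [pow_succ]
      change (F ^ i) (F j) = _
      have := ih (j + 1)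
      push_cast at this ⊢
      rw [hFj, this]
      ring
  let B : ℕ → ℝ ≃o ℝ := fun i =>
    ((OrderIso.addLeft (1 : ℝ)).trans (F ^ i)).trans (OrderIso.addRight (-(1 + i) : ℝ))
  have hB : ∀ i y, B i y = (F ^ i) (1 + y) - (1 + i) := fun i y => by
    change (F ^ i) (1 + y) + -(1 + i : ℝ) = _
    ring
  have hB0 : ∀ i, B i 0 = 0 := fun i => by
    have := hpowj i 1
    rw [hB]; push_cast at this; rw [add_zero, this]; ring
  have hB1 : ∀ i, B i 1 = 1 := fun i => by
    have := hpowj i 2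
    rw [hB]; push_cast at this; rw [one_add_one_eq_two, this]; ring
  let R : ℕ → (Ioo (0 : ℝ) 1 ≃o Ioo (0 : ℝ) 1) := fun i => restrictIoo (B i) (hB0 i) (hB1 i)
  have hR : ∀ i y, ((R i y : Ioo (0 : ℝ) 1) : ℝ) = (F ^ i) (1 + y) - (1 + i) := fun i y => hB i y
  let e : ℤ → (Ioo (0 : ℝ) 1 ≃o Ioo (0 : ℝ) 1) := fun j =>
    (R ((j - 1) % k).toNat).symm.trans
      ((Φ.symm.trans (σ.trans Φ)).trans (R ((j - 1) % k).toNat))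
  have he : ∀ j, e (j + k) = e j := by
    intro j
    have : (j + k - 1) % (k : ℤ) = (j - 1) % k := by
      rw [show j + (k : ℤ) - 1 = j - 1 + k by ring, Int.add_emod_right]
    simp only [e, this]
  have hper : ∀ x, glue e (x + k) = glue e x + k := by
    intro x
    change glueFun e (x + k) = glueFun e x + k
    rcases int_or_cell x with ⟨i, rfl⟩ | ⟨i, y, rfl⟩
    · have := glueFun_int e (i + k)
      push_cast at this
      rw [glueFun_int, this]
    · have := glueFun_cell e (i + k) y
      push_cast at this
      rw [add_assoc, this, he, glueFun_cell]
      ring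
  obtain ⟨τ, hτ⟩ := exists_descent hk (glue e) hper
  have hτ1 : ∀ j : ℤ, τ.1 (vertex k j) = vertex k j := by
    intro j
    rw [vertex, hτ]
    change circlePoint k (glueFun e j) = _
    rw [glueFun_int]
  have hτ2 : ∀ i : ℕ, i < k → ∀ t : ℝ,
      τ.1 ((f ^ i).1 (arcMap k Φ t)) = (f ^ i).1 (arcMap k Φ (σ t)) := by
    intro i hi t
    rw [arcMap, arcMap, hpow, hpow, hτ]
    have hx : (F ^ i) (1 + Φ t) = (R i (Φ t) : ℝ) + ((1 + i : ℤ) : ℝ) := by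
      rw [hR]; push_cast; ring
    have hx' : (F ^ i) (1 + Φ (σ t)) = (R i (Φ (σ t)) : ℝ) + ((1 + i : ℤ) : ℝ) := by
      rw [hR]; push_cast; ring
    rw [hx, hx']
    change circlePoint k (glueFun e _) = _
    rw [glueFun_cell]
    have hr : (((1 + i : ℤ) - 1) % (k : ℤ)).toNat = i := by
      rw [add_sub_cancel_left, Int.emod_eq_of_lt (by omega) (by omega)]
      rfl
    have : e (1 + i) (R i (Φ t)) = R i (Φ (σ t)) := by
      simp only [e, hr]
      change R i (Φ (σ (Φ.symm ((R i).symm (R i (Φ t)))))) = _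
      rw [OrderIso.symm_apply_apply, OrderIso.symm_apply_apply]
    rw [this]
  refine ⟨τ, ⟨hτ1, hτ2⟩, ?_⟩
  rintro τ' ⟨h1, h2⟩
  apply Subtype.ext
  apply Homeomorph.ext
  intro z
  obtain ⟨x, rfl⟩ := circlePoint_surjective hk z
  rcases int_or_cell x with ⟨j, rfl⟩ | ⟨j, y, rfl⟩
  · exact (h1 j).trans (hτ1 j).symm
  · have hk0 : (0 : ℤ) < k := by omega
    obtain ⟨i, hi⟩ : ∃ i : ℕ, (j - 1) % (k : ℤ) = i :=
      ⟨_, (Int.toNat_of_nonneg (Int.emod_nonneg _ hk0.ne')).symm⟩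
    have hik : i < k := by
      have := Int.emod_lt_of_pos (j - 1) hk0
      omega
    obtain ⟨s, rfl⟩ := (R i).surjective y
    obtain ⟨t, rfl⟩ := Φ.surjective s
    have hz : circlePoint k ((R i (Φ t) : ℝ) + j) = (f ^ i).1 (arcMap k Φ t) := by
      rw [arcMap, hpow, circlePoint_eq_iff hk, hR]
      refine ⟨(j - 1) / k, ?_⟩
      have h3 := Int.emod_add_mul_ediv (j - 1) k
      rw [hi] at h3
      have h4 : (i : ℝ) + k * ((j - 1) / k : ℤ) = j - 1 := by exact_mod_cast h3
      linarith
    rw [hz, h2 i hik t, hτ2 i hik t]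

end Extension

end CircleZn

namespace CircleZn

/-! ### Translations of the line and homeomorphisms that shift the integers. -/

open Set

/-! The proof rests on commutativity and on recognising special points as fixed points of group
elements.

On the line, integer translations commute with every `hbar ℏ σ`, so above level 2 each element is `L
m * hbar ℏ τ`. Hence the line groups are abelian (`lineGroup_commute`), and a fixed point forces m =
0 (`exists_hbar_of_fixed`). Since `hbar ℏ (L 1)` fixes exactly the integers, a conjugator between
two such groups permutes ℤ; corrected by a translation and restricted to (0, 1), it gives a
conjugator one level down. The descent ends at level 2, where an order isomorphism ℤ + ℤα' → ℤ + ℤα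
is a multiplication and yields a Möbius relation (`eq_and_mobiusEquiv_of_conjugators`). Conversely,
a scaling conjugates at level 2 and `hbar` carries it upwards (`conjugators_nonempty`).

On the circle, f commutes with the extensions of elements of G, and f^k is the extension of g. So
every element is f^i times an extension, and those with a fixed point are extensions
(`exists_ext_of_fixed`). The extension of `L 1` fixes only the vertices, so a conjugacy Ψ matches
vertices with vertices and k = k'. Composed with a power of f', Ψ fixes the vertices and restricts
to some ψ conjugating the line groups; it sends f to f' times an extension of some h, and k-th
powers give ψ g ψ⁻¹ = g' h^k (`exists_conjugator_of_topConj`). Conversely, replacing f' by its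
product with the extension of h keeps the group but turns g' into g' h^k, and ψ is spread over all
arcs to conjugate the groups (`topConj_of_conjugator`). Independence of f is the case ψ = h = 1. -/

theorem mul_apply_real (σ τ : HomeoPlusReal) (x : ℝ) : (σ * τ) x = σ (τ x) := rfl

theorem inv_apply_self_real (σ : HomeoPlusReal) (x : ℝ) : σ⁻¹ (σ x) = x := σ.symm_apply_apply x

theorem apply_inv_self_real (σ : HomeoPlusReal) (x : ℝ) : σ (σ⁻¹ x) = x := σ.apply_symm_apply x

theorem L_apply (a x : ℝ) : L a x = x + a := rfl

theorem L_mul (a b : ℝ) : L a * L b = L (a + b) := by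
  ext x
  simp only [mul_apply_real, L_apply]
  ring

theorem L_zero : L 0 = 1 := by
  ext x
  simp [L_apply]

theorem L_inv (a : ℝ) : (L a)⁻¹ = L (-a) := by
  rw [inv_eq_iff_mul_eq_one, L_mul, add_neg_cancel, L_zero]

theorem L_zpow (a : ℝ) (m : ℤ) : L a ^ m = L (m * a) := by
  induction m using Int.induction_on with
  | zero => simp [L_zero]
  | succ i ih => rw [zpow_add_one, ih, L_mul]; congr 1; push_cast; ring
  | pred i ih => rw [zpow_sub_one, ih, L_inv, L_mul]; congr 1; push_cast; ring

/-- An increasing homeomorphism of the line acts on the integers as the translation by `a`. -/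
def ShiftsBy (F : HomeoPlusReal) (a : ℤ) : Prop := ∀ j : ℤ, F j = j + a

theorem ShiftsBy.mul {F H : HomeoPlusReal} {a b : ℤ} (hF : ShiftsBy F a) (hH : ShiftsBy H b) :
    ShiftsBy (F * H) (a + b) := by
  intro j
  have := hF (j + b)
  push_cast at this ⊢
  rw [mul_apply_real, hH, this]
  ring

theorem ShiftsBy.inv {F : HomeoPlusReal} {a : ℤ} (hF : ShiftsBy F a) : ShiftsBy F⁻¹ (-a) := by
  intro j
  have := hF (j - a)
  push_cast at this ⊢
  rw [sub_add_cancel] at this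
  calc F⁻¹ j = F⁻¹ (F (j - a)) := by rw [this]
    _ = j + -a := by rw [inv_apply_self_real]; ring

/-- Monotonicity traps `F x` between the images of two consecutive integers. This is how a fixed
point is turned into a vanishing shift. -/
theorem ShiftsBy.floor {F : HomeoPlusReal} {a : ℤ} (hF : ShiftsBy F a) (x : ℝ) :
    ⌊F x⌋ = ⌊x⌋ + a := by
  rw [Int.floor_eq_iff]
  have h1 := F.monotone (Int.floor_le x)
  have h2 := F.strictMono (Int.lt_floor_add_one x)
  have h3 := hF (⌊x⌋ + 1)
  push_cast at h3 ⊢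
  rw [hF] at h1
  rw [h3] at h2
  exact ⟨h1, by linarith⟩

/-- An increasing homeomorphism of the line permuting the integers translates them. -/
theorem exists_shiftsBy (F : HomeoPlusReal) (hZ : ∀ j : ℤ, ∃ l : ℤ, F j = l)
    (hZ' : ∀ l : ℤ, ∃ j : ℤ, F j = l) : ∃ a : ℤ, ShiftsBy F a := by
  have hstep : ∀ j : ℤ, F (j + 1 : ℤ) = F j + 1 := by
    intro j
    obtain ⟨a, ha⟩ := hZ j
    obtain ⟨b, hb⟩ := hZ (j + 1)
    have hab : a < b := by
      have : F j < F (j + 1 : ℤ) := F.lt_iff_lt.2 (by push_cast; linarith)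
      rw [ha, hb] at this
      exact_mod_cast this
    -- The integer preimage of a + 1 lies beyond j, hence at or beyond j + 1, so F cannot skip an
    -- integer.
    obtain ⟨c, hc⟩ := hZ' (a + 1)
    have h1 : j < c := by
      have : F j < F c := by rw [ha, hc]; push_cast; linarith
      exact_mod_cast F.lt_iff_lt.1 this
    have h2 : (F (j + 1 : ℤ) : ℝ) ≤ F c := F.le_iff_le.2 (by exact_mod_cast h1)
    rw [hb, hc] at h2
    have h3 : b ≤ a + 1 := by exact_mod_cast h2
    have : b = a + 1 := by omega
    rw [ha, hb, this]
    push_cast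
    ring
  obtain ⟨a, ha⟩ := hZ 0
  refine ⟨a, fun j => ?_⟩
  induction j using Int.induction_on with
  | zero => rw [ha]; simp
  | succ i ih => rw [hstep, ih]; push_cast; ring
  | pred i ih =>
    have := hstep (-i - 1)
    rw [show (-(i : ℤ) - 1 + 1) = -i by ring, ih] at this
    push_cast at this ⊢
    linarith

/-! ### The homomorphism `σ ↦ ℏ(σ)`. -/

section Hbar

variable (ℏ : ℝ ≃ₜ Ioo (0 : ℝ) 1)

/-- `σ ↦ ℏ(σ)` as a group homomorphism. -/
noncomputable def hbarHom : HomeoPlusReal →* HomeoPlusReal :=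
  MonoidHom.mk' (hbar ℏ) fun σ τ => by
    ext x
    rw [mul_apply_real]
    rcases int_or_cell x with ⟨i, rfl⟩ | ⟨i, y, rfl⟩
    · simp only [hbar_int]
    · rw [hbar_cell, hbar_cell, hbar_cell, ℏ.symm_apply_apply, mul_apply_real]

theorem hbarHom_apply (σ : HomeoPlusReal) : hbarHom ℏ σ = hbar ℏ σ := rfl

theorem hbar_shiftsBy (σ : HomeoPlusReal) : ShiftsBy (hbar ℏ σ) 0 := fun j => by
  rw [hbar_int]; simp

theorem hbar_add_int (σ : HomeoPlusReal) (x : ℝ) (m : ℤ) :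
    hbar ℏ σ (x + m) = hbar ℏ σ x + m := by
  rcases int_or_cell x with ⟨i, rfl⟩ | ⟨i, y, rfl⟩
  · have := hbar_int ℏ σ (i + m)
    push_cast at this
    rw [this, hbar_int]
  · have := hbar_cell ℏ σ (i + m) y
    push_cast at this
    rw [add_assoc, this, hbar_cell]
    ring

/-- The same map is used on every unit cell, so `hbar ℏ σ` is 1-periodic. -/
theorem commute_L_hbar (σ : HomeoPlusReal) (m : ℤ) : Commute (L m) (hbar ℏ σ) := by
  ext x
  simp only [mul_apply_real, L_apply, hbar_add_int]

/-- Inside a cell the map is conjugate to a translation without fixed points. This characterises ℤ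
through the group action. -/
theorem exists_int_of_hbar_L_one_fixed {x : ℝ} (h : hbar ℏ (L 1) x = x) : ∃ i : ℤ, x = i := by
  rcases int_or_cell x with hi | ⟨i, y, rfl⟩
  · exact hi
  · rw [hbar_cell, add_left_inj] at h
    have h2 := congrArg ℏ.symm (Subtype.ext h)
    rw [ℏ.symm_apply_apply, L_apply] at h2
    linarith

/-- The increasing homeomorphism `ℏ⁻¹ e ℏ` of the line, for an automorphism `e` of `(0, 1)`. -/
noncomputable def pullIoo (e : Ioo (0 : ℝ) 1 ≃o Ioo (0 : ℝ) 1) : HomeoPlusReal where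
  toEquiv := (ℏ.toEquiv.trans e.toEquiv).trans ℏ.symm.toEquiv
  map_rel_iff' := by
    intro a b
    change ℏ.symm (e (ℏ a)) ≤ ℏ.symm (e (ℏ b)) ↔ a ≤ b
    have hc : Continuous fun t : ℝ => (ℏ t : ℝ) := continuous_subtype_val.comp ℏ.continuous
    have hi : Function.Injective fun t : ℝ => (ℏ t : ℝ) :=
      Subtype.val_injective.comp ℏ.injective
    -- The homeomorphism `ℏ` may be decreasing; conjugating by it preserves monotonicity in either
    -- case.
    rcases hc.strictMono_of_inj hi with h | h
    · have h' : ∀ s t, ℏ s ≤ ℏ t ↔ s ≤ t := fun s t => h.le_iff_le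
      rw [← h', ℏ.apply_symm_apply, ℏ.apply_symm_apply, e.le_iff_le, h']
    · have h' : ∀ s t, ℏ s ≤ ℏ t ↔ t ≤ s := fun s t => h.le_iff_ge
      rw [← h', ℏ.apply_symm_apply, ℏ.apply_symm_apply, e.le_iff_le, h']

/-- A homeomorphism of the line fixing the integers agrees on `(0, 1)` with some `ℏ(ψ)`. -/
theorem exists_eq_hbar_on_Ioo {F : HomeoPlusReal} (hF : ShiftsBy F 0) :
    ∃ ψ : HomeoPlusReal, ∀ y : Ioo (0 : ℝ) 1, F y = ℏ (ψ (ℏ.symm y)) := by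
  have h0 : F 0 = 0 := by simpa using hF 0
  have h1 : F 1 = 1 := by simpa using hF 1
  refine ⟨pullIoo ℏ (restrictIoo F h0 h1), fun y => ?_⟩
  change _ = ((ℏ (ℏ.symm (restrictIoo F h0 h1 (ℏ (ℏ.symm y)))) : Ioo (0 : ℝ) 1) : ℝ)
  rw [ℏ.apply_symm_apply, ℏ.apply_symm_apply]
  rfl

end Hbar

/-! ### Structure of the line groups: normal form, commutativity, elements with a fixed point. -/

section LineGroup

variable {ℏ : ℝ ≃ₜ Ioo (0 : ℝ) 1} {α : ℝ}

theorem L_one_mem_lineGroup {n : ℕ} (hn : 2 ≤ n) : L 1 ∈ lineGroup ℏ α n := by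
  match n, hn with
  | 2, _ => exact Subgroup.subset_closure (by simp)
  | n + 3, _ => exact Subgroup.subset_closure (by simp)

theorem L_int_mem_lineGroup {n : ℕ} (hn : 2 ≤ n) (m : ℤ) : L m ∈ lineGroup ℏ α n := by
  have := (lineGroup ℏ α n).zpow_mem (L_one_mem_lineGroup hn) m
  rwa [L_zpow, mul_one] at this

theorem mem_lineGroup_two {σ : HomeoPlusReal} :
    σ ∈ lineGroup ℏ α 2 ↔ ∃ p q : ℤ, σ = L (p + q * α) := by
  constructor
  · intro h
    induction h using Subgroup.closure_induction with
    | mem x hx =>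
      rcases hx with rfl | rfl
      · exact ⟨1, 0, by simp⟩
      · exact ⟨0, 1, by simp⟩
    | one => exact ⟨0, 0, by simp [L_zero]⟩
    | mul x y _ _ hx hy =>
      obtain ⟨p, q, rfl⟩ := hx
      obtain ⟨r, s, rfl⟩ := hy
      refine ⟨p + r, q + s, ?_⟩
      rw [L_mul]
      congr 1
      push_cast
      ring
    | inv x _ hx =>
      obtain ⟨p, q, rfl⟩ := hx
      refine ⟨-p, -q, ?_⟩
      rw [L_inv]
      congr 1
      push_cast
      ring
  · rintro ⟨p, q, rfl⟩
    have h1 : L 1 ∈ lineGroup ℏ α 2 := Subgroup.subset_closure (by simp)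
    have h2 : L α ∈ lineGroup ℏ α 2 := Subgroup.subset_closure (by simp)
    have := mul_mem (zpow_mem h1 p) (zpow_mem h2 q)
    rwa [L_zpow, L_zpow, L_mul, mul_one] at this

theorem hbar_mem_lineGroup {n : ℕ} {σ : HomeoPlusReal} (hσ : σ ∈ lineGroup ℏ α (n + 2)) :
    hbar ℏ σ ∈ lineGroup ℏ α (n + 3) :=
  Subgroup.subset_closure (Or.inl ⟨σ, hσ, rfl⟩)

/-- The two kinds of generators commute and `hbar` is a homomorphism, so translations can be
collected on the left. -/
theorem exists_of_mem_lineGroup {n : ℕ} {σ : HomeoPlusReal} (h : σ ∈ lineGroup ℏ α (n + 3)) :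
    ∃ m : ℤ, ∃ τ ∈ lineGroup ℏ α (n + 2), σ = L m * hbar ℏ τ := by
  induction h using Subgroup.closure_induction with
  | mem x hx =>
    rcases hx with ⟨τ, hτ, rfl⟩ | rfl
    · exact ⟨0, τ, hτ, by simp [L_zero]⟩
    · exact ⟨1, 1, one_mem _, by rw [← hbarHom_apply, map_one, Int.cast_one, mul_one]⟩
  | one => exact ⟨0, 1, one_mem _, by rw [← hbarHom_apply, map_one, Int.cast_zero, mul_one, L_zero]⟩
  | mul x y _ _ hx hy =>
    obtain ⟨m, τ, hτ, rfl⟩ := hx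
    obtain ⟨l, ρ, hρ, rfl⟩ := hy
    refine ⟨m + l, τ * ρ, mul_mem hτ hρ, ?_⟩
    rw [Int.cast_add, ← L_mul, ← hbarHom_apply ℏ (τ * ρ), map_mul, hbarHom_apply, hbarHom_apply,
      (commute_L_hbar ℏ τ l).symm.mul_mul_mul_comm]
  | inv x _ hx =>
    obtain ⟨m, τ, hτ, rfl⟩ := hx
    refine ⟨-m, τ⁻¹, inv_mem hτ, ?_⟩
    rw [(commute_L_hbar ℏ τ m).mul_inv, Int.cast_neg, ← L_inv, ← hbarHom_apply, ← hbarHom_apply,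
      map_inv]

theorem lineGroup_commute {n : ℕ} (hn : 2 ≤ n) {σ τ : HomeoPlusReal}
    (hσ : σ ∈ lineGroup ℏ α n) (hτ : τ ∈ lineGroup ℏ α n) : Commute σ τ := by
  induction n, hn using Nat.le_induction generalizing σ τ with
  | base =>
    obtain ⟨p, q, rfl⟩ := mem_lineGroup_two.1 hσ
    obtain ⟨r, s, rfl⟩ := mem_lineGroup_two.1 hτ
    rw [commute_iff_eq, L_mul, L_mul, add_comm]
  | succ n hn ih =>
    obtain ⟨n, rfl⟩ := Nat.exists_eq_add_of_le' hn
    obtain ⟨m, σ, hσ', rfl⟩ := exists_of_mem_lineGroup hσ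
    obtain ⟨l, τ, hτ', rfl⟩ := exists_of_mem_lineGroup hτ
    have h1 : Commute (L m) (L l) := by rw [commute_iff_eq, L_mul, L_mul, add_comm]
    have h2 : Commute (hbar ℏ σ) (hbar ℏ τ) := (ih hσ' hτ').map (hbarHom ℏ)
    exact (h1.mul_right (commute_L_hbar ℏ τ m)).mul_left
      ((commute_L_hbar ℏ σ l).symm.mul_right h2)

/-- In the normal form `L m * hbar ℏ τ` the second factor preserves integer parts and the first adds
m to them, so m = 0. -/
theorem exists_hbar_of_fixed {n : ℕ} {σ : HomeoPlusReal} (h : σ ∈ lineGroup ℏ α (n + 3)) {x : ℝ}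
    (hx : σ x = x) : ∃ τ ∈ lineGroup ℏ α (n + 2), σ = hbar ℏ τ := by
  obtain ⟨m, τ, hτ, rfl⟩ := exists_of_mem_lineGroup h
  have h1 := (hbar_shiftsBy ℏ τ).floor x
  rw [mul_apply_real, L_apply] at hx
  have h2 := congrArg Int.floor hx
  rw [Int.floor_add_intCast, h1] at h2
  obtain rfl : m = 0 := by omega
  exact ⟨τ, hτ, by simp [L_zero]⟩

end LineGroup

/-! ### Conjugacy classification of the line groups. -/

section Conjugators

/-- The intertwining form σψ = ψσ' can be evaluated at points and pushed through `hbar` without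
inverses. -/
theorem mem_conjugators_iff {G G' : Subgroup HomeoPlusReal} {ψ : HomeoPlusReal} :
    ψ ∈ conjugators G G' ↔ (∀ σ ∈ G, ∃ σ' ∈ G', σ * ψ = ψ * σ') ∧
      ∀ σ' ∈ G', ∃ σ ∈ G, σ * ψ = ψ * σ' := by
  have key : ∀ σ σ' : HomeoPlusReal, σ * ψ = ψ * σ' ↔ MulAut.conj ψ σ' = σ := fun σ σ' => by
    rw [MulAut.conj_apply, mul_inv_eq_iff_eq_mul, eq_comm]
  simp only [key]
  constructor
  · rintro (h : G = _)
    refine ⟨fun σ hσ => ?_, fun σ' hσ' => ?_⟩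
    · rw [h] at hσ
      exact hσ
    · exact ⟨_, by rw [h]; exact ⟨σ', hσ', rfl⟩, rfl⟩
  · rintro ⟨h1, h2⟩
    refine le_antisymm (fun σ hσ => h1 σ hσ) ?_
    rintro _ ⟨σ', hσ', rfl⟩
    obtain ⟨σ, hσ, h⟩ := h2 σ' hσ'
    exact (show _ = σ from h) ▸ hσ

theorem conjugators_inv {G G' : Subgroup HomeoPlusReal} {ψ : HomeoPlusReal}
    (h : ψ ∈ conjugators G G') : ψ⁻¹ ∈ conjugators G' G := by
  rw [mem_conjugators_iff] at h ⊢
  have key : ∀ σ σ' : HomeoPlusReal, σ * ψ = ψ * σ' → σ' * ψ⁻¹ = ψ⁻¹ * σ := fun σ σ' e => by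
    rw [eq_inv_mul_iff_mul_eq, ← mul_assoc, ← e, mul_inv_cancel_right]
  exact ⟨fun σ' h' => (h.2 σ' h').imp fun σ hσ => ⟨hσ.1, key _ _ hσ.2⟩,
    fun σ h' => (h.1 σ h').imp fun σ hσ => ⟨hσ.1, key _ _ hσ.2⟩⟩

theorem conjugators_mul {G G' G'' : Subgroup HomeoPlusReal} {ψ χ : HomeoPlusReal}
    (h : ψ ∈ conjugators G G') (h' : χ ∈ conjugators G' G'') : ψ * χ ∈ conjugators G G'' := by
  change G = _
  rw [map_mul]
  change G = G''.map ((MulAut.conj ψ).toMonoidHom.comp (MulAut.conj χ).toMonoidHom)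
  rw [← Subgroup.map_map, ← (show G' = _ from h')]
  exact h

theorem mem_conjugators_self {G : Subgroup HomeoPlusReal} {ψ : HomeoPlusReal} (h : ψ ∈ G) :
    ψ ∈ conjugators G G :=
  mem_conjugators_iff.2
    ⟨fun σ hσ => ⟨ψ⁻¹ * σ * ψ, mul_mem (mul_mem (inv_mem h) hσ) h, by group⟩,
      fun σ hσ => ⟨ψ * σ * ψ⁻¹, mul_mem (mul_mem h hσ) (inv_mem h), by group⟩⟩

theorem mem_lineNormalizer_iff {G : Subgroup HomeoPlusReal} {ψ : HomeoPlusReal} :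
    ψ ∈ lineNormalizer G ↔ ψ ∈ conjugators G G := eq_comm

variable {ℏ : ℝ ≃ₜ Ioo (0 : ℝ) 1} {α α' : ℝ}

/-- Multiplication by a positive number. -/
noncomputable def scale (c : ℝ) (hc : 0 < c) : HomeoPlusReal := OrderIso.mulLeft₀ c hc

theorem scale_apply (c : ℝ) (hc : 0 < c) (x : ℝ) : scale c hc x = c * x := rfl

/-- Multiplication by ±(m₂ + n₂α) takes ℤ + ℤα' onto ℤ + ℤα, because it takes 1 and α' to a ℤ-basis.
-/
theorem conjugators_two_nonempty (hα : Irrational α) (h : MobiusEquiv α α') :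
    (conjugators (lineGroup ℏ α 2) (lineGroup ℏ α' 2)).Nonempty := by
  obtain ⟨m₁, n₁, m₂, n₂, hdet, hα'⟩ := h
  have hc : (m₂ + n₂ * α : ℝ) ≠ 0 := by
    intro h0
    by_cases hn : n₂ = 0
    · subst hn
      have : m₂ = 0 := by simpa using h0
      subst this
      simp at hdet
    · have hn' : (n₂ : ℝ) ≠ 0 := by exact_mod_cast hn
      refine hα ⟨-m₂ / n₂, ?_⟩
      push_cast
      field_simp
      linarith
  have hmul : (m₂ + n₂ * α) * α' = m₁ + n₁ * α := by rw [hα']; field_simp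
  -- The sign s makes the scaling factor positive, hence the scaling increasing.
  obtain ⟨s, hs, hsc⟩ : ∃ s : ℤ, s * s = 1 ∧ 0 < (s : ℝ) * (m₂ + n₂ * α) := by
    rcases lt_or_gt_of_ne hc with h | h
    · exact ⟨-1, by norm_num, by push_cast; linarith⟩
    · exact ⟨1, by norm_num, by push_cast; linarith⟩
  obtain ⟨d, hd, hdd⟩ : ∃ d : ℤ, d = m₁ * n₂ - n₁ * m₂ ∧ d * d = 1 :=
    ⟨_, rfl, by rw [← abs_mul_abs_self, hdet]; norm_num⟩
  refine ⟨scale _ hsc, mem_conjugators_iff.2 ⟨fun σ hσ => ?_, fun σ' hσ' => ?_⟩⟩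
  · obtain ⟨p, q, rfl⟩ := mem_lineGroup_two.1 hσ
    -- The coefficients come from Cramer's rule; the determinant d is its own inverse.
    refine ⟨_, mem_lineGroup_two.2 ⟨s * d * (q * m₁ - p * n₁), s * d * (p * n₂ - q * m₂), rfl⟩, ?_⟩
    ext x
    simp only [mul_apply_real, L_apply, scale_apply]
    have e1 : (s : ℝ) * s = 1 := by exact_mod_cast hs
    have e2 : (d : ℝ) * d = 1 := by exact_mod_cast hdd
    have e3 : (d : ℝ) = m₁ * n₂ - n₁ * m₂ := by exact_mod_cast hd
    push_cast
    have key : (s : ℝ) * (m₂ + n₂ * α) * (s * d * (q * m₁ - p * n₁) + s * d * (p * n₂ - q * m₂) * α')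
        = (s * s) * d * ((m₂ + n₂ * α) * (q * m₁ - p * n₁) +
          (p * n₂ - q * m₂) * ((m₂ + n₂ * α) * α')) := by ring
    rw [e1, hmul] at key
    have : (m₂ + n₂ * α) * (q * m₁ - p * n₁) + (p * n₂ - q * m₂) * (m₁ + n₁ * α)
        = (m₁ * n₂ - n₁ * m₂) * (p + q * α) := by ring
    rw [this, ← e3, one_mul, ← mul_assoc (d : ℝ) d, e2, one_mul] at key
    rw [← key]
    ring
  · obtain ⟨p, q, rfl⟩ := mem_lineGroup_two.1 hσ'
    refine ⟨_, mem_lineGroup_two.2 ⟨s * (p * m₂ + q * m₁), s * (p * n₂ + q * n₁), rfl⟩, ?_⟩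
    ext x
    simp only [mul_apply_real, L_apply, scale_apply]
    push_cast
    linear_combination (-(s : ℝ) * q) * hmul

/-- Applying `hbar` to σψ = ψσ' gives the relation for the second factors, and `hbar ℏ ψ` commutes
with the translation factors. -/
theorem hbar_mem_conjugators {n : ℕ} {ψ : HomeoPlusReal}
    (h : ψ ∈ conjugators (lineGroup ℏ α (n + 2)) (lineGroup ℏ α' (n + 2))) :
    hbar ℏ ψ ∈ conjugators (lineGroup ℏ α (n + 3)) (lineGroup ℏ α' (n + 3)) := by
  rw [mem_conjugators_iff] at h ⊢
  have key : ∀ (m : ℤ) (σ σ' : HomeoPlusReal), σ * ψ = ψ * σ' →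
      L m * hbar ℏ σ * hbar ℏ ψ = hbar ℏ ψ * (L m * hbar ℏ σ') := fun m σ σ' e => by
    have := congrArg (hbarHom ℏ) e
    rw [map_mul, map_mul] at this
    simp only [hbarHom_apply] at this
    rw [mul_assoc, this, ← mul_assoc, ← mul_assoc, (commute_L_hbar ℏ ψ m).eq]
  constructor
  · intro ρ hρ
    obtain ⟨m, σ, hσ, rfl⟩ := exists_of_mem_lineGroup hρ
    obtain ⟨σ', hσ', e⟩ := h.1 σ hσ
    exact ⟨_, mul_mem (L_int_mem_lineGroup (by omega) m) (hbar_mem_lineGroup hσ'), key m _ _ e⟩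
  · intro ρ hρ
    obtain ⟨m, σ', hσ', rfl⟩ := exists_of_mem_lineGroup hρ
    obtain ⟨σ, hσ, e⟩ := h.2 σ' hσ'
    exact ⟨_, mul_mem (L_int_mem_lineGroup (by omega) m) (hbar_mem_lineGroup hσ), key m _ _ e⟩

theorem conjugators_nonempty {n : ℕ} (hn : 2 ≤ n) (hα : Irrational α) (h : MobiusEquiv α α') :
    (conjugators (lineGroup ℏ α n) (lineGroup ℏ α' n)).Nonempty := by
  induction n, hn using Nat.le_induction with
  | base => exact conjugators_two_nonempty hα h
  | succ n hn ih =>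
    obtain ⟨n, rfl⟩ := Nat.exists_eq_add_of_le' hn
    obtain ⟨ψ, hψ⟩ := ih
    exact ⟨_, hbar_mem_conjugators hψ⟩

/-- A homomorphism `p + q a ↦ p c + q d` preserving positivity is the multiplication by `c`. -/
theorem eq_mul_of_pos_imp_pos {a c d : ℝ} (hc : 0 < c)
    (h : ∀ p q : ℤ, 0 < p + q * a → 0 < p * c + q * d) : d = a * c := by
  rcases lt_trichotomy (d / c) a with hlt | heq | hlt
  · obtain ⟨r, h1, h2⟩ := exists_rat_btwn hlt
    have hq : (0 : ℝ) < r.den := by exact_mod_cast r.den_pos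
    rw [Rat.cast_def, div_lt_div_iff₀ hc hq] at h1
    rw [Rat.cast_def, div_lt_iff₀ hq] at h2
    have := h (-r.num) r.den (by push_cast; linarith)
    push_cast at this
    linarith
  · rw [← heq]
    field_simp
  · obtain ⟨r, h1, h2⟩ := exists_rat_btwn hlt
    have hq : (0 : ℝ) < r.den := by exact_mod_cast r.den_pos
    rw [Rat.cast_def, div_lt_div_iff₀ hq hc] at h2
    rw [Rat.cast_def, lt_div_iff₀ hq] at h1
    have := h r.num (-r.den) (by push_cast; linarith)
    push_cast at this
    linarith

theorem int_add_mul_irrational_inj (hα : Irrational α) {p q r s : ℤ}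
    (h : (p + q * α : ℝ) = r + s * α) : p = r ∧ q = s := by
  have hq : q = s := by
    by_contra hne
    have hne' : (q - s : ℝ) ≠ 0 := sub_ne_zero.2 (by exact_mod_cast hne)
    refine hα ⟨(r - p) / (q - s), ?_⟩
    push_cast
    field_simp
    linarith
  subst hq
  exact ⟨by exact_mod_cast add_right_cancel h, rfl⟩

/-- Conjugation by ψ is an additive bijection ℤ + ℤα' → ℤ + ℤα. It preserves positivity since ψ is
increasing, so it is multiplication by the image m₂ + n₂α of 1, and α' is the quotient of the images
of α' and 1. -/
theorem mobiusEquiv_of_conjugators_two (hα : Irrational α) {ψ : HomeoPlusReal}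
    (h : ψ ∈ conjugators (lineGroup ℏ α 2) (lineGroup ℏ α' 2)) : MobiusEquiv α α' := by
  obtain ⟨h1, h2⟩ := mem_conjugators_iff.1 h
  have push : ∀ p q : ℤ, ∃ r s : ℤ, ∀ x, ψ (x + (p + q * α')) = ψ x + (r + s * α) := by
    intro p q
    obtain ⟨σ, hσ, e⟩ := h2 _ (mem_lineGroup_two.2 ⟨p, q, rfl⟩)
    obtain ⟨r, s, rfl⟩ := mem_lineGroup_two.1 hσ
    exact ⟨r, s, fun x => (DFunLike.congr_fun e x).symm⟩
  have pull : ∀ r s : ℤ, ∃ p q : ℤ, ∀ x, ψ (x + (p + q * α')) = ψ x + (r + s * α) := by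
    intro r s
    obtain ⟨σ, hσ, e⟩ := h1 _ (mem_lineGroup_two.2 ⟨r, s, rfl⟩)
    obtain ⟨p, q, rfl⟩ := mem_lineGroup_two.1 hσ
    exact ⟨p, q, fun x => (DFunLike.congr_fun e x).symm⟩
  have iter : ∀ a b : ℝ, (∀ x, ψ (x + a) = ψ x + b) → ∀ (m : ℤ) x, ψ (x + m * a) = ψ x + m * b := by
    intro a b hab m x
    have e : L b * ψ = ψ * L a := by
      ext x
      exact (hab x).symm
    have e2 : SemiconjBy ψ (L a) (L b) := e.symm
    have := DFunLike.congr_fun (e2.zpow_right m).eq x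
    rwa [L_zpow, L_zpow] at this
  obtain ⟨m₂, n₂, hc⟩ := push 1 0
  obtain ⟨m₁, n₁, hd⟩ := push 0 1
  simp only [Int.cast_one, Int.cast_zero, zero_mul, one_mul, add_zero, zero_add] at hc hd
  have hpq : ∀ (p q : ℤ) x, ψ (x + (p + q * α')) =
      ψ x + (p * (m₂ + n₂ * α) + q * (m₁ + n₁ * α)) := by
    intro p q x
    have e1 := iter _ _ hc p (x + q * α')
    have e2 := iter _ _ hd q x
    rw [mul_one] at e1
    rw [show x + (p + q * α') = x + q * α' + p by ring, e1, e2]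
    ring
  have hcpos : (0 : ℝ) < m₂ + n₂ * α := by
    have : ψ 0 < ψ (0 + 1) := ψ.strictMono (by norm_num)
    rw [hc] at this
    linarith
  have hmul := eq_mul_of_pos_imp_pos (a := α') (d := m₁ + n₁ * α) hcpos fun p q hpos => by
    have : ψ 0 < ψ (0 + (p + q * α')) := ψ.strictMono (by linarith)
    rw [hpq] at this
    linarith
  refine ⟨m₁, n₁, m₂, n₂, ?_, by rw [hmul]; field_simp⟩
  obtain ⟨u, v, huv⟩ := pull 1 0
  obtain ⟨u', v', huv'⟩ := pull 0 1
  have e1 := huv 0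
  have e2 := huv' 0
  rw [hpq, add_right_inj] at e1 e2
  obtain ⟨a1, a2⟩ := int_add_mul_irrational_inj hα (p := u * m₂ + v * m₁) (q := u * n₂ + v * n₁)
    (r := 1) (s := 0) (by push_cast at e1 ⊢; linarith)
  obtain ⟨b1, b2⟩ := int_add_mul_irrational_inj hα (p := u' * m₂ + v' * m₁)
    (q := u' * n₂ + v' * n₁) (r := 0) (s := 1) (by push_cast at e2 ⊢; linarith)
  -- Preimages of 1 and α provide an inverse integer matrix; this is the product of the
  -- determinants.
  have hdet : (m₁ * n₂ - n₁ * m₂) * (v * u' - u * v') = 1 := by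
    linear_combination (u' * n₂ + v' * n₁) * a1 + b2 - (u' * m₂ + v' * m₁) * a2
  exact Int.isUnit_iff_abs_eq.1 (IsUnit.of_mul_eq_one _ hdet)

/-- The conjugate of `hbar ℏ (L 1)` by ψ⁻¹ has a fixed point, hence is some `hbar ℏ τ` and fixes
every integer j. So `hbar ℏ (L 1)` fixes ψ j. -/
theorem exists_int_of_conjugators {n n' : ℕ} {ψ : HomeoPlusReal}
    (h : ψ ∈ conjugators (lineGroup ℏ α (n + 3)) (lineGroup ℏ α' (n' + 3))) (j : ℤ) :
    ∃ l : ℤ, ψ j = l := by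
  obtain ⟨σ', hσ', e⟩ := (mem_conjugators_iff.1 h).1 _
    (hbar_mem_lineGroup (L_one_mem_lineGroup (by omega)))
  have e' := fun x : ℝ => DFunLike.congr_fun e x
  simp only [mul_apply_real] at e'
  have hfix : σ' (ψ⁻¹ 0) = ψ⁻¹ 0 := ψ.injective <| by
    have := hbar_int ℏ (L 1) 0
    rw [← e', apply_inv_self_real]
    simpa using this
  obtain ⟨τ, -, rfl⟩ := exists_hbar_of_fixed hσ' hfix
  apply exists_int_of_hbar_L_one_fixed ℏ
  rw [e', hbar_int]

/-- After a correction by a translation in the group, ψ fixes ℤ. Its restriction to (0, 1), read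
through `ℏ`, intertwines the groups one level down. -/
theorem exists_conjugator_of_succ {n n' : ℕ} {ψ : HomeoPlusReal}
    (h : ψ ∈ conjugators (lineGroup ℏ α (n + 3)) (lineGroup ℏ α' (n' + 3))) :
    (conjugators (lineGroup ℏ α (n + 2)) (lineGroup ℏ α' (n' + 2))).Nonempty := by
  obtain ⟨a, ha⟩ := exists_shiftsBy ψ (exists_int_of_conjugators h) fun l => by
    obtain ⟨j, hj⟩ := exists_int_of_conjugators (conjugators_inv h) l
    exact ⟨j, by rw [← hj, apply_inv_self_real]⟩
  have hL : L (-a : ℤ) ∈ conjugators (lineGroup ℏ α (n + 3)) (lineGroup ℏ α (n + 3)) :=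
    mem_conjugators_self (L_int_mem_lineGroup (by omega) _)
  have h' := conjugators_mul hL h
  have hs : ShiftsBy (L (-a : ℤ) * ψ) 0 := fun j => by
    rw [mul_apply_real, L_apply, ha]; push_cast; ring
  generalize L (-a : ℤ) * ψ = χ at h' hs
  obtain ⟨ρ, hρ⟩ := exists_eq_hbar_on_Ioo ℏ hs
  have key : ∀ τ τ' : HomeoPlusReal, hbar ℏ τ * χ = χ * hbar ℏ τ' → τ * ρ = ρ * τ' := by
    intro τ τ' e
    have hcell : ∀ (σ : HomeoPlusReal) (y : Ioo (0 : ℝ) 1), hbar ℏ σ y = ℏ (σ (ℏ.symm y)) := by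
      intro σ y
      simpa using hbar_cell ℏ σ 0 y
    ext t
    have := DFunLike.congr_fun e (ℏ t : ℝ)
    rw [mul_apply_real, mul_apply_real, hρ, hcell, hcell, hρ] at this
    have := ℏ.injective (Subtype.ext this)
    simpa only [mul_apply_real, ℏ.symm_apply_apply] using this
  have hfix : χ 0 = 0 := by simpa using hs 0
  have hfix0 : ∀ τ, hbar ℏ τ 0 = 0 := fun τ => by simpa using hbar_int ℏ τ 0
  refine ⟨ρ, mem_conjugators_iff.2 ⟨fun τ hτ => ?_, fun τ' hτ' => ?_⟩⟩
  · obtain ⟨σ', hσ', e⟩ := (mem_conjugators_iff.1 h').1 _ (hbar_mem_lineGroup hτ)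
    have e' := DFunLike.congr_fun e (0 : ℝ)
    rw [mul_apply_real, mul_apply_real, hfix, hfix0] at e'
    -- The partner of `hbar ℏ τ` fixes 0 because χ does, so it has no translation part.
    obtain ⟨τ', hτ', rfl⟩ := exists_hbar_of_fixed hσ' (x := 0)
      (χ.injective (by rw [← e', hfix]))
    exact ⟨τ', hτ', key _ _ e⟩
  · obtain ⟨σ, hσ, e⟩ := (mem_conjugators_iff.1 h').2 _ (hbar_mem_lineGroup hτ')
    have e' := DFunLike.congr_fun e (0 : ℝ)
    rw [mul_apply_real, mul_apply_real, hfix0, hfix] at e'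
    obtain ⟨τ, hτ, rfl⟩ := exists_hbar_of_fixed hσ e'
    exact ⟨τ, hτ, key _ _ e⟩

/-- Level 2 acts freely, whereas `hbar ℏ (L 1)` fixes 0 without being the identity (it moves 1/2).
-/
theorem conjugators_two_succ_empty {n : ℕ} {ψ : HomeoPlusReal} :
    ψ ∉ conjugators (lineGroup ℏ α 2) (lineGroup ℏ α' (n + 3)) := by
  intro h
  obtain ⟨σ, hσ, e⟩ := (mem_conjugators_iff.1 h).2 _
    (hbar_mem_lineGroup (L_one_mem_lineGroup (by omega)))
  obtain ⟨p, q, rfl⟩ := mem_lineGroup_two.1 hσ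
  have e0 := DFunLike.congr_fun e (0 : ℝ)
  rw [mul_apply_real, mul_apply_real, show hbar ℏ (L 1) 0 = 0 by simpa using hbar_int ℏ (L 1) 0,
    L_apply, add_eq_left] at e0
  rw [e0, L_zero, one_mul, left_eq_mul] at e
  obtain ⟨i, hi⟩ := exists_int_of_hbar_L_one_fixed ℏ (x := 1 / 2) (by rw [e]; rfl)
  have : (2 * i : ℤ) = 1 := by
    have : (2 * i : ℝ) = 1 := by rw [← hi]; norm_num
    exact_mod_cast this
  omega

theorem eq_and_mobiusEquiv_of_conjugators {n n' : ℕ} (hn : 2 ≤ n) (hn' : 2 ≤ n')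
    (hα : Irrational α) {ψ : HomeoPlusReal}
    (h : ψ ∈ conjugators (lineGroup ℏ α n) (lineGroup ℏ α' n')) :
    n = n' ∧ MobiusEquiv α α' := by
  induction n, hn using Nat.le_induction generalizing n' ψ with
  | base =>
    match n', hn' with
    | 2, _ => exact ⟨rfl, mobiusEquiv_of_conjugators_two hα h⟩
    | n' + 3, _ => exact absurd h conjugators_two_succ_empty
  | succ n hn ih =>
    obtain ⟨n, rfl⟩ := Nat.exists_eq_add_of_le' hn
    match n', hn' with
    | 2, _ => exact absurd (conjugators_inv h) conjugators_two_succ_empty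
    | n' + 3, _ =>
      obtain ⟨χ, hχ⟩ := exists_conjugator_of_succ h
      obtain ⟨h1, h2⟩ := ih (Nat.le_add_left 2 n') hχ
      exact ⟨by omega, h2⟩

end Conjugators

/-! ### Circle homeomorphisms permuting the vertices, and their lifts. -/

theorem mul_apply_circle (f h : HomeoPlusCircle) (z : Circle) : (f * h).1 z = f.1 (h.1 z) := rfl

theorem inv_apply_self_circle (f : HomeoPlusCircle) (z : Circle) : f⁻¹.1 (f.1 z) = z :=
  f.1.symm_apply_apply z

theorem apply_inv_self_circle (f : HomeoPlusCircle) (z : Circle) : f.1 (f⁻¹.1 z) = z :=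
  f.1.apply_symm_apply z

theorem circle_ext {f h : HomeoPlusCircle} (H : ∀ z, f.1 z = h.1 z) : f = h :=
  Subtype.ext (Homeomorph.ext H)

/-- `F` is a lift of `f` along `circlePoint k` which translates the integers by `a`. -/
structure IsShiftLift (k : ℕ) (f : HomeoPlusCircle) (F : HomeoPlusReal) (a : ℤ) : Prop where
  lift : ∀ x, f.1 (circlePoint k x) = circlePoint k (F x)
  shift : ShiftsBy F a

namespace IsShiftLift

variable {k : ℕ} {f h : HomeoPlusCircle} {F H : HomeoPlusReal} {a b : ℤ}

theorem one : IsShiftLift k 1 1 0 := ⟨fun _ => rfl, fun j => by simp⟩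

theorem mul (hf : IsShiftLift k f F a) (hh : IsShiftLift k h H b) :
    IsShiftLift k (f * h) (F * H) (a + b) :=
  ⟨fun x => by rw [mul_apply_circle, hh.lift, hf.lift, mul_apply_real], hf.shift.mul hh.shift⟩

theorem inv (hf : IsShiftLift k f F a) : IsShiftLift k f⁻¹ F⁻¹ (-a) :=
  ⟨fun x => f.1.injective (by rw [apply_inv_self_circle, hf.lift, apply_inv_self_real]),
    hf.shift.inv⟩

theorem pow (hf : IsShiftLift k f F a) (i : ℕ) : IsShiftLift k (f ^ i) (F ^ i) (i * a) := by
  induction i with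
  | zero => simpa using one
  | succ i ih =>
    have := ih.mul hf
    rwa [← pow_succ, ← pow_succ, show (i * a + a : ℤ) = (i + 1 : ℕ) * a by push_cast; ring] at this

theorem zpow (hf : IsShiftLift k f F a) (i : ℤ) : IsShiftLift k (f ^ i) (F ^ i) (i * a) := by
  obtain ⟨i, rfl | rfl⟩ := i.eq_nat_or_neg
  · simpa using hf.pow i
  · simpa using (hf.pow i).inv

theorem apply_vertex (hf : IsShiftLift k f F a) (j : ℤ) : f.1 (vertex k j) = vertex k (j + a) := by
  rw [vertex, vertex, hf.lift, hf.shift]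
  push_cast
  rfl

/-- A homeomorphism of the circle with a fixed point shifts the vertices trivially. -/
theorem dvd_of_fixed (hk : 1 ≤ k) (hf : IsShiftLift k f F a) {z : Circle} (hz : f.1 z = z) :
    (k : ℤ) ∣ a := by
  obtain ⟨x, rfl⟩ := circlePoint_surjective hk z
  rw [hf.lift, circlePoint_eq_iff hk] at hz
  obtain ⟨m, hm⟩ := hz
  have h1 := hf.shift.floor x
  rw [hm, show (m * k : ℝ) = ((m * k : ℤ) : ℝ) by push_cast; rfl, Int.floor_add_intCast,
    add_right_inj] at h1
  exact ⟨m, by rw [← h1, mul_comm]⟩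

end IsShiftLift

theorem vertex_eq_iff {k : ℕ} (hk : 1 ≤ k) (i j : ℤ) : vertex k i = vertex k j ↔ (k : ℤ) ∣ i - j := by
  rw [vertex, vertex, circlePoint_eq_iff hk]
  refine exists_congr fun m => ?_
  rw [sub_eq_iff_eq_add', mul_comm (k : ℤ)]
  exact_mod_cast Iff.rfl

/-- A homeomorphism permuting the vertices has a lift permuting the integers. -/
theorem exists_isShiftLift {k : ℕ} (hk : 1 ≤ k) (f : HomeoPlusCircle)
    (h : ∀ j : ℤ, ∃ l : ℤ, f.1 (vertex k j) = vertex k l)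
    (h' : ∀ l : ℤ, ∃ j : ℤ, f.1 (vertex k j) = vertex k l) : ∃ F a, IsShiftLift k f F a := by
  obtain ⟨F, hF⟩ := exists_lift hk f
  obtain ⟨a, ha⟩ := exists_shiftsBy F (fun j => by
    obtain ⟨l, hl⟩ := h j
    rw [vertex, vertex, hF, circlePoint_eq_iff hk] at hl
    obtain ⟨m, hm⟩ := hl
    exact ⟨l + m * k, by rw [hm]; push_cast; rfl⟩) fun l => by
    obtain ⟨j, hj⟩ := h' l
    rw [vertex, vertex, ← F.apply_symm_apply (l : ℝ), ← hF] at hj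
    obtain ⟨m, hm⟩ := (circlePoint_eq_iff hk _ _).1 (f.1.injective hj)
    refine ⟨j - m * k, ?_⟩
    rw [← OrderIso.eq_symm_apply]
    push_cast
    linarith
  exact ⟨F, a, hF, ha⟩

/-- A homeomorphism fixing the vertices has a lift fixing the integers. -/
theorem exists_isShiftLift_zero {k : ℕ} (hk : 1 ≤ k) (f : HomeoPlusCircle)
    (h : ∀ j : ℤ, f.1 (vertex k j) = vertex k j) : ∃ F, IsShiftLift k f F 0 := by
  obtain ⟨F, a, hF⟩ := exists_isShiftLift hk f (fun j => ⟨j, h j⟩) fun j => ⟨j, h j⟩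
  obtain ⟨m, rfl⟩ := hF.dvd_of_fixed hk (h 0)
  -- `circlePoint k` has period k, so a lift may be changed by any multiple of k.
  refine ⟨L (-(m * k)) * F, fun x => ?_, fun j => ?_⟩
  · rw [hF.lift, circlePoint_eq_iff hk]
    exact ⟨m, by rw [mul_apply_real, L_apply]; ring⟩
  · rw [mul_apply_real, L_apply, hF.shift]
    push_cast
    ring

/-! ### Arcs between consecutive vertices: restriction and transport. -/

section Arc

variable {k : ℕ} {Φ : ℝ ≃o Ioo (0 : ℝ) 1}

theorem arcMap_injective (hk : 1 ≤ k) : Function.Injective (arcMap k Φ) := by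
  intro s t h
  obtain ⟨m, hm⟩ := (circlePoint_eq_iff hk _ _).1 h
  have h1 := congrArg Int.floor hm
  rw [show (m * k : ℝ) = ((m * k : ℤ) : ℝ) by push_cast; rfl, Int.floor_add_intCast] at h1
  have hfl : ∀ y : Ioo (0 : ℝ) 1, ⌊1 + (y : ℝ)⌋ = 1 := fun y => by
    rw [Int.floor_eq_iff]
    constructor
    · push_cast; linarith [y.2.1]
    · push_cast; linarith [y.2.2]
  rw [hfl, hfl, left_eq_add] at h1
  have h2 : (m * k : ℝ) = 0 := by exact_mod_cast h1
  rw [h2, add_zero, add_right_inj] at hm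
  exact Φ.injective (Subtype.ext hm)

/-- A homeomorphism of the circle fixing the vertices restricts to the arc. -/
theorem exists_restrict_arc (hk : 1 ≤ k) (Φ : ℝ ≃o Ioo (0 : ℝ) 1) (f : HomeoPlusCircle)
    (h : ∀ j : ℤ, f.1 (vertex k j) = vertex k j) :
    ∃ ψ : HomeoPlusReal, ∀ t, f.1 (arcMap k Φ t) = arcMap k Φ (ψ t) := by
  obtain ⟨F, hF⟩ := exists_isShiftLift_zero hk f h
  -- The arc (x_1, x_2) lifts to (1, 2); conjugating by `L 1` moves it to (0, 1).
  let B : ℝ ≃o ℝ := L (-1) * F * L 1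
  have hB : ∀ y, B y = F (y + 1) + -1 := fun y => rfl
  have hB0 : B 0 = 0 := by
    have := hF.shift 1
    push_cast at this
    rw [hB, zero_add, this]
    ring
  have hB1 : B 1 = 1 := by
    have := hF.shift 2
    push_cast at this
    rw [hB, one_add_one_eq_two, this]
    ring
  refine ⟨(Φ.trans (restrictIoo B hB0 hB1)).trans Φ.symm, fun t => ?_⟩
  change _ = circlePoint k (1 + (Φ (Φ.symm (restrictIoo B hB0 hB1 (Φ t))) : Ioo (0 : ℝ) 1))
  rw [Φ.apply_symm_apply, arcMap, hF.lift]
  change _ = circlePoint k (1 + B (Φ t))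
  rw [hB, add_comm 1 (Φ t : ℝ)]
  congr 1
  ring

variable {f f₁ : HomeoPlusCircle}

theorem exists_isShiftLift_one (hk : 1 ≤ k)
    (hf : ∀ j : ℤ, f.1 (vertex k j) = vertex k (j + 1)) : ∃ F, IsShiftLift k f F 1 := by
  obtain ⟨F, h1, h2⟩ := exists_shift_lift hk f hf
  exact ⟨F, h1, fun j => by rw [h2]; push_cast; rfl⟩

/-- Points of the circle are vertices or lie on an arc `f^i (x_1, x_2)`. -/
theorem vertex_or_arc (hk : 1 ≤ k) (Φ : ℝ ≃o Ioo (0 : ℝ) 1)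
    (hf : ∀ j : ℤ, f.1 (vertex k j) = vertex k (j + 1)) (z : Circle) :
    (∃ j : ℤ, z = vertex k j) ∨ ∃ i < k, ∃ t, z = (f ^ i).1 (arcMap k Φ t) := by
  obtain ⟨F, hF⟩ := exists_isShiftLift_one hk hf
  obtain ⟨x, rfl⟩ := circlePoint_surjective hk z
  rcases int_or_cell x with ⟨j, rfl⟩ | ⟨j, y, rfl⟩
  · exact Or.inl ⟨j, rfl⟩
  right
  have hk0 : (0 : ℤ) < k := by omega
  -- f^i takes the cell (1, 2) to (1 + i, 2 + i), so the cell starting at j needs i ≡ j - 1 modulo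
  -- k.
  obtain ⟨i, hi⟩ : ∃ i : ℕ, (j - 1) % (k : ℤ) = i :=
    ⟨_, (Int.toNat_of_nonneg (Int.emod_nonneg _ hk0.ne')).symm⟩
  have hik : i < k := by
    have := Int.emod_lt_of_pos (j - 1) hk0
    omega
  have hFi := hF.pow i
  set u := (F ^ i)⁻¹ (y + (1 + i)) with hu
  have hu' : (F ^ i) u = y + (1 + i) := apply_inv_self_real _ _
  have h1 := hFi.shift 1
  have h2 := hFi.shift 2
  push_cast at h1 h2
  have hu1 : 1 < u := (F ^ i).lt_iff_lt.1 (by rw [hu', h1]; linarith [y.2.1])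
  have hu2 : u < 2 := (F ^ i).lt_iff_lt.1 (by rw [hu', h2]; linarith [y.2.2])
  refine ⟨i, hik, Φ.symm ⟨u - 1, by linarith, by linarith⟩, ?_⟩
  rw [arcMap, Φ.apply_symm_apply, hFi.lift, circlePoint_eq_iff hk]
  refine ⟨(j - 1) / k, ?_⟩
  change _ = (F ^ i) (1 + (u - 1)) + _
  rw [add_sub_cancel, hu']
  have h3 := Int.emod_add_mul_ediv (j - 1) k
  rw [hi] at h3
  have h4 : (i : ℝ) + k * ((j - 1) / k : ℤ) = j - 1 := by exact_mod_cast h3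
  linarith

theorem circle_ext_of_arcs (hk : 1 ≤ k) (Φ : ℝ ≃o Ioo (0 : ℝ) 1)
    (hf : ∀ j : ℤ, f.1 (vertex k j) = vertex k (j + 1)) {τ τ' : HomeoPlusCircle}
    (h : ∀ j : ℤ, τ.1 (vertex k j) = τ'.1 (vertex k j))
    (h' : ∀ i < k, ∀ t, τ.1 ((f ^ i).1 (arcMap k Φ t)) = τ'.1 ((f ^ i).1 (arcMap k Φ t))) :
    τ = τ' := circle_ext fun z => by
  rcases vertex_or_arc hk Φ hf z with ⟨j, rfl⟩ | ⟨i, hi, t, rfl⟩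
  · exact h j
  · exact h' i hi t

/-- Transport of the arcs `f^i (x_1, x_2)` onto the arcs `f₁^i (x_1, x_2)`. -/
theorem exists_transport (hk : 1 ≤ k) (Φ : ℝ ≃o Ioo (0 : ℝ) 1)
    (hf : ∀ j : ℤ, f.1 (vertex k j) = vertex k (j + 1))
    (hf₁ : ∀ j : ℤ, f₁.1 (vertex k j) = vertex k (j + 1)) (σ : HomeoPlusReal) :
    ∃ Ψ : HomeoPlusCircle, (∀ j : ℤ, Ψ.1 (vertex k j) = vertex k j) ∧
      ∀ i < k, ∀ t, Ψ.1 ((f ^ i).1 (arcMap k Φ t)) = (f₁ ^ i).1 (arcMap k Φ (σ t)) := by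
  have cells : ∀ h : HomeoPlusCircle, (∀ j : ℤ, h.1 (vertex k j) = vertex k (j + 1)) →
      ∃ R : ℕ → (Ioo (0 : ℝ) 1 ≃o Ioo (0 : ℝ) 1), ∀ i t,
        (h ^ i).1 (arcMap k Φ t) = circlePoint k ((R i (Φ t) : ℝ) + ((1 + i : ℤ) : ℝ)) := by
    intro h hh
    obtain ⟨F, hF⟩ := exists_isShiftLift_one hk hh
    let B : ℕ → ℝ ≃o ℝ := fun i => L (-(1 + i)) * F ^ i * L 1
    have hB : ∀ i y, B i y = (F ^ i) (y + 1) + -(1 + i) := fun i y => rfl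
    have hB0 : ∀ i, B i 0 = 0 := fun i => by
      have := (hF.pow i).shift 1
      push_cast at this
      rw [hB, zero_add, this]
      ring
    have hB1 : ∀ i, B i 1 = 1 := fun i => by
      have := (hF.pow i).shift 2
      push_cast at this
      rw [hB, one_add_one_eq_two, this]
      ring
    refine ⟨fun i => restrictIoo (B i) (hB0 i) (hB1 i), fun i t => ?_⟩
    rw [arcMap, (hF.pow i).lift]
    change _ = circlePoint k (B i (Φ t) + _)
    rw [hB, add_comm 1 (Φ t : ℝ)]
    congr 1
    push_cast
    ring
  obtain ⟨R, hR⟩ := cells f hf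
  obtain ⟨R₁, hR₁⟩ := cells f₁ hf₁
  -- On cell j: back to the base arc along f, then σ, then out along f₁. Reducing the index modulo k
  -- makes the glued map periodic, so it descends to the circle.
  let e : ℤ → (Ioo (0 : ℝ) 1 ≃o Ioo (0 : ℝ) 1) := fun j =>
    (R ((j - 1) % k).toNat).symm.trans
      ((Φ.symm.trans (σ.trans Φ)).trans (R₁ ((j - 1) % k).toNat))
  have he : ∀ j, e (j + k) = e j := by
    intro j
    have : (j + k - 1) % (k : ℤ) = (j - 1) % k := by
      rw [show j + (k : ℤ) - 1 = j - 1 + k by ring, Int.add_emod_right]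
    simp only [e, this]
  have hper : ∀ x, glue e (x + k) = glue e x + k := by
    intro x
    change glueFun e (x + k) = glueFun e x + k
    rcases int_or_cell x with ⟨i, rfl⟩ | ⟨i, y, rfl⟩
    · have := glueFun_int e (i + k)
      push_cast at this
      rw [glueFun_int, this]
    · have := glueFun_cell e (i + k) y
      push_cast at this
      rw [add_assoc, this, he, glueFun_cell]
      ring
  obtain ⟨Ψ, hΨ⟩ := exists_descent hk (glue e) hper
  refine ⟨Ψ, fun j => ?_, fun i hi t => ?_⟩
  · rw [vertex, hΨ]
    change circlePoint k (glueFun e j) = _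
    rw [glueFun_int]
  · rw [hR, hR₁, hΨ]
    change circlePoint k (glueFun e _) = _
    have hr : (((1 + i : ℤ) - 1) % (k : ℤ)).toNat = i := by
      rw [add_sub_cancel_left, Int.emod_eq_of_lt (by omega) (by omega)]
      rfl
    have : e (1 + i) (R i (Φ t)) = R₁ i (Φ (σ t)) := by
      simp only [e, hr]
      change R₁ i (Φ (σ (Φ.symm ((R i).symm (R i (Φ t)))))) = _
      rw [OrderIso.symm_apply_apply, OrderIso.symm_apply_apply]
    rw [glueFun_cell, this]

end Arc

/-! ### Extensions along f and the structure of the circle group. -/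

section Extension

variable {k : ℕ} {Φ : ℝ ≃o Ioo (0 : ℝ) 1} {f : HomeoPlusCircle} {g σ σ' : HomeoPlusReal}
  {τ τ' : HomeoPlusCircle}

theorem IsExtension.apply_arc (h : IsExtension k Φ f σ τ) (hk : 1 ≤ k) (t : ℝ) :
    τ.1 (arcMap k Φ t) = arcMap k Φ (σ t) := h.2 0 hk t

theorem IsExtension.mul (h : IsExtension k Φ f σ τ) (h' : IsExtension k Φ f σ' τ') :
    IsExtension k Φ f (σ * σ') (τ * τ') :=
  ⟨fun j => by rw [mul_apply_circle, h'.1, h.1],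
    fun i hi t => by rw [mul_apply_circle, h'.2 i hi, h.2 i hi, mul_apply_real]⟩

theorem IsExtension.unique (hk : 1 ≤ k) (hf : ∀ j : ℤ, f.1 (vertex k j) = vertex k (j + 1))
    (h : IsExtension k Φ f σ τ) (h' : IsExtension k Φ f σ τ') : τ = τ' :=
  (existsUnique_extension hk Φ f hf σ).unique h h'

/-- The extension `σ ↦ σ̄^f` as a group homomorphism. -/
noncomputable def extHom (hk : 1 ≤ k) (Φ : ℝ ≃o Ioo (0 : ℝ) 1)
    (hf : ∀ j : ℤ, f.1 (vertex k j) = vertex k (j + 1)) : HomeoPlusReal →* HomeoPlusCircle :=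
  MonoidHom.mk' (fun σ => (existsUnique_extension hk Φ f hf σ).choose) fun σ σ' =>
    IsExtension.unique hk hf (existsUnique_extension hk Φ f hf (σ * σ')).choose_spec.1
      ((existsUnique_extension hk Φ f hf σ).choose_spec.1.mul
        (existsUnique_extension hk Φ f hf σ').choose_spec.1)

theorem isExtension_extHom (hk : 1 ≤ k) (Φ : ℝ ≃o Ioo (0 : ℝ) 1)
    (hf : ∀ j : ℤ, f.1 (vertex k j) = vertex k (j + 1)) (σ : HomeoPlusReal) :
    IsExtension k Φ f σ (extHom hk Φ hf σ) :=
  (existsUnique_extension hk Φ f hf σ).choose_spec.1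

theorem IsExtension.eq_extHom (hk : 1 ≤ k) (hf : ∀ j : ℤ, f.1 (vertex k j) = vertex k (j + 1))
    (h : IsExtension k Φ f σ τ) : τ = extHom hk Φ hf σ :=
  h.unique hk hf (isExtension_extHom hk Φ hf σ)

/-- Commuting with f propagates the action from the first arc to all the others. -/
theorem isExtension_of_commute (h : ∀ j : ℤ, τ.1 (vertex k j) = vertex k j) (hc : Commute τ f)
    (ha : ∀ t, τ.1 (arcMap k Φ t) = arcMap k Φ (σ t)) : IsExtension k Φ f σ τ :=
  ⟨h, fun i _ t => by
    rw [← mul_apply_circle, (hc.pow_right i).eq, mul_apply_circle, ha]⟩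

theorem pow_apply_vertex (hf : ∀ j : ℤ, f.1 (vertex k j) = vertex k (j + 1)) (i : ℕ) (j : ℤ) :
    (f ^ i).1 (vertex k j) = vertex k (j + i) := by
  induction i generalizing j with
  | zero => simp
  | succ i ih =>
    rw [pow_succ, mul_apply_circle, hf, ih]
    congr 1
    push_cast
    ring

theorem vertex_add_self (hk : 1 ≤ k) (j : ℤ) : vertex k (j + k) = vertex k j := by
  rw [vertex_eq_iff hk, add_sub_cancel_left]

theorem rootSet_vertex (hf : f ∈ rootSet k Φ g) (j : ℤ) : f.1 (vertex k j) = vertex k (j + 1) :=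
  hf.1 j

theorem rootSet_pow (hf : f ∈ rootSet k Φ g) (t : ℝ) :
    (f ^ k).1 (arcMap k Φ t) = arcMap k Φ (g t) :=
  hf.2 t

theorem isExtension_pow (hk : 1 ≤ k) (hf : f ∈ rootSet k Φ g) : IsExtension k Φ f g (f ^ k) :=
  isExtension_of_commute (fun j => by rw [pow_apply_vertex (rootSet_vertex hf), vertex_add_self hk])
    (Commute.pow_self f k) (rootSet_pow hf)

/-- From arc i to arc i + 1 the relation is built into the extension. Only the return to the first
arc, where f^k acts as g, needs σ and g to commute. -/
theorem commute_extHom (hk : 1 ≤ k) (hf : f ∈ rootSet k Φ g) (hc : Commute σ g) :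
    Commute (extHom hk Φ (rootSet_vertex hf) σ) f := by
  have hσ := isExtension_extHom hk Φ (rootSet_vertex hf) σ
  refine circle_ext_of_arcs hk Φ (rootSet_vertex hf) (fun j => ?_) fun i hi t => ?_
  · rw [mul_apply_circle, mul_apply_circle, (rootSet_vertex hf), hσ.1, hσ.1, (rootSet_vertex hf)]
  · have hs : ∀ z, f.1 ((f ^ i).1 z) = (f ^ (i + 1)).1 z := fun z => by
      rw [pow_succ', mul_apply_circle]
    rw [mul_apply_circle, mul_apply_circle, hσ.2 i hi, hs, hs]
    rcases Nat.lt_or_ge (i + 1) k with h | h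
    · exact hσ.2 _ h t
    · obtain rfl : i + 1 = k := by omega
      rw [rootSet_pow hf, rootSet_pow hf, hσ.apply_arc hk]
      exact congrArg _ (DFunLike.congr_fun hc.eq t)

theorem pow_eq_extHom (hk : 1 ≤ k) (hf : f ∈ rootSet k Φ g) : f ^ k = extHom hk Φ (rootSet_vertex hf) g :=
  (isExtension_pow hk hf).eq_extHom hk (rootSet_vertex hf)

variable {G : Subgroup HomeoPlusReal}

theorem extHom_mem (hk : 1 ≤ k) (hf : ∀ j : ℤ, f.1 (vertex k j) = vertex k (j + 1)) (hσ : σ ∈ G) :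
    extHom hk Φ hf σ ∈ circleGroup G k Φ f :=
  Subgroup.subset_closure (Or.inl ⟨σ, hσ, isExtension_extHom hk Φ hf σ⟩)

theorem self_mem_circleGroup : f ∈ circleGroup G k Φ f :=
  Subgroup.subset_closure (Or.inr rfl)

/-- Since f commutes with the extensions of elements of G, its powers can be collected on the left.
-/
theorem exists_of_mem_circleGroup (hk : 1 ≤ k) (hf : f ∈ rootSet k Φ g)
    (hG : ∀ σ ∈ G, Commute σ g) {x : HomeoPlusCircle} (hx : x ∈ circleGroup G k Φ f) :
    ∃ i : ℤ, ∃ σ ∈ G, x = f ^ i * extHom hk Φ (rootSet_vertex hf) σ := by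
  induction hx using Subgroup.closure_induction with
  | mem x hx =>
    rcases hx with ⟨σ, hσ, h⟩ | rfl
    · exact ⟨0, σ, hσ, by rw [zpow_zero, one_mul, h.eq_extHom hk (rootSet_vertex hf)]⟩
    · exact ⟨1, 1, one_mem _, by rw [map_one, zpow_one, mul_one]⟩
  | one => exact ⟨0, 1, one_mem _, by rw [map_one, zpow_zero, mul_one]⟩
  | mul x y _ _ hx hy =>
    obtain ⟨i, σ, hσ, rfl⟩ := hx
    obtain ⟨j, σ', hσ', rfl⟩ := hy
    refine ⟨i + j, σ * σ', mul_mem hσ hσ', ?_⟩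
    rw [map_mul, zpow_add, ((commute_extHom hk hf (hG σ hσ)).zpow_right j).mul_mul_mul_comm]
  | inv x _ hx =>
    obtain ⟨i, σ, hσ, rfl⟩ := hx
    refine ⟨-i, σ⁻¹, inv_mem hσ, ?_⟩
    rw [map_inv, zpow_neg, ((commute_extHom hk hf (hG σ hσ)).zpow_right i).symm.mul_inv]

/-- An element of the circle group which translates the vertices by `a` modulo `k` is
`f^a` times an extension. -/
theorem exists_of_mem_of_shift (hk : 1 ≤ k) (hf : f ∈ rootSet k Φ g) (hg : g ∈ G)
    {i a : ℤ} (hi : (k : ℤ) ∣ i - a) (hσ : σ ∈ G) :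
    ∃ ρ ∈ G, f ^ i * extHom hk Φ (rootSet_vertex hf) σ = f ^ a * extHom hk Φ (rootSet_vertex hf) ρ := by
  obtain ⟨q, hq⟩ := hi
  -- The surplus power f^(kq) is the extension of g^q.
  refine ⟨g ^ q * σ, mul_mem (zpow_mem hg q) hσ, ?_⟩
  rw [map_mul, map_zpow, ← pow_eq_extHom hk hf, ← zpow_natCast, ← zpow_mul, ← mul_assoc,
    ← zpow_add, ← hq, add_sub_cancel]

/-- An element f^i times an extension shifts the vertices by i; a fixed point forces k to divide i,
and then f^i is itself an extension. -/
theorem exists_ext_of_fixed (hk : 1 ≤ k) (hf : f ∈ rootSet k Φ g) (hg : g ∈ G)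
    (hG : ∀ σ ∈ G, Commute σ g) {x : HomeoPlusCircle} (hx : x ∈ circleGroup G k Φ f) {z : Circle}
    (hz : x.1 z = z) : ∃ σ ∈ G, x = extHom hk Φ (rootSet_vertex hf) σ := by
  obtain ⟨i, σ, hσ, rfl⟩ := exists_of_mem_circleGroup hk hf hG hx
  obtain ⟨F, hF⟩ := exists_isShiftLift_one hk (rootSet_vertex hf)
  obtain ⟨S, hS⟩ := exists_isShiftLift_zero hk _ (isExtension_extHom hk Φ (rootSet_vertex hf) σ).1
  have := ((hF.zpow i).mul hS).dvd_of_fixed hk hz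
  obtain ⟨ρ, hρ, e⟩ := exists_of_mem_of_shift hk hf hg (a := 0) (by simpa using this) hσ
  exact ⟨ρ, hρ, by rw [e, zpow_zero, one_mul]⟩

theorem exists_mul_ext_of_shift_one (hk : 1 ≤ k) (hf : f ∈ rootSet k Φ g) (hg : g ∈ G)
    (hG : ∀ σ ∈ G, Commute σ g) {x : HomeoPlusCircle} (hx : x ∈ circleGroup G k Φ f)
    (h : ∀ j : ℤ, x.1 (vertex k j) = vertex k (j + 1)) :
    ∃ σ ∈ G, x = f * extHom hk Φ (rootSet_vertex hf) σ := by
  have hx' : f⁻¹ * x ∈ circleGroup G k Φ f := mul_mem (inv_mem self_mem_circleGroup) hx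
  obtain ⟨σ, hσ, e⟩ := exists_ext_of_fixed hk hf hg hG hx' (z := vertex k 0) (by
    rw [mul_apply_circle, h, ← (rootSet_vertex hf), inv_apply_self_circle])
  exact ⟨σ, hσ, by rw [← e, mul_inv_cancel_left]⟩

/-- The fixed points of the extension of a fixed point free homeomorphism are the vertices. -/
theorem exists_vertex_of_fixed (hk : 1 ≤ k) (hf : ∀ j : ℤ, f.1 (vertex k j) = vertex k (j + 1))
    (h : ∀ t, σ t ≠ t) {z : Circle} (hz : (extHom hk Φ hf σ).1 z = z) : ∃ j, z = vertex k j := by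
  rcases vertex_or_arc hk Φ hf z with hj | ⟨i, hi, t, rfl⟩
  · exact hj
  · rw [(isExtension_extHom hk Φ hf σ).2 i hi] at hz
    exact absurd (arcMap_injective hk ((f ^ i).1.injective hz)) (h t)

end Extension

/-! ### Conjugacy of circle groups. -/

section Conjugacy

theorem map_conj_eq_iff {A : Type*} [Group A] {H K : Subgroup A} {x : A} :
    H.map (MulAut.conj x).toMonoidHom = K ↔
      (∀ y ∈ H, x * y * x⁻¹ ∈ K) ∧ ∀ y ∈ K, x⁻¹ * y * x ∈ H := by
  constructor
  · rintro rfl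
    refine ⟨fun y hy => ⟨y, hy, rfl⟩, ?_⟩
    rintro _ ⟨y, hy, rfl⟩
    have : x⁻¹ * (x * y * x⁻¹) * x = y := by group
    exact this.symm ▸ hy
  · rintro ⟨h1, h2⟩
    refine le_antisymm ?_ fun y hy => ⟨_, h2 y hy, ?_⟩
    · rintro _ ⟨y, hy, rfl⟩
      exact h1 y hy
    · change x * (x⁻¹ * y * x) * x⁻¹ = y
      group

variable {k k' : ℕ} {Φ Φ' : ℝ ≃o Ioo (0 : ℝ) 1} {f f' f₁ Ψ : HomeoPlusCircle}
  {g g' h ψ : HomeoPlusReal} {G G' : Subgroup HomeoPlusReal}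

/-- The map acting as ψ from each arc of f to the corresponding arc of f₁ conjugates f to f₁. The
only condition arises on closing up after k steps, and it holds because f₁^k is ψgψ⁻¹ on the base
arc. -/
theorem topConj_circleGroup_map (hk : 1 ≤ k) (hf : f ∈ rootSet k Φ g)
    (hf₁ : f₁ ∈ rootSet k Φ (ψ * g * ψ⁻¹)) :
    TopConj (circleGroup G k Φ f) (circleGroup (G.map (MulAut.conj ψ).toMonoidHom) k Φ f₁) := by
  obtain ⟨Ψ, hΨ, hΨa⟩ := exists_transport hk Φ (rootSet_vertex hf) (rootSet_vertex hf₁) ψ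
  have hc : Ψ * f = f₁ * Ψ := by
    refine circle_ext_of_arcs hk Φ (rootSet_vertex hf) (fun j => ?_) fun i hi t => ?_
    · rw [mul_apply_circle, mul_apply_circle, hΨ, rootSet_vertex hf, rootSet_vertex hf₁, hΨ]
    · have hs : ∀ (u : HomeoPlusCircle) z, u.1 ((u ^ i).1 z) = (u ^ (i + 1)).1 z := fun u z => by
        rw [pow_succ', mul_apply_circle]
      rw [mul_apply_circle, mul_apply_circle, hΨa i hi, hs, hs]
      rcases Nat.lt_or_ge (i + 1) k with h | h
      · exact hΨa _ h t
      · obtain rfl : i + 1 = k := by omega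
        have h0 : ∀ t, Ψ.1 (arcMap (i + 1) Φ t) = arcMap (i + 1) Φ (ψ t) := hΨa 0 hk
        rw [rootSet_pow hf, rootSet_pow hf₁, h0, mul_apply_real, mul_apply_real,
          inv_apply_self_real]
  have hconj : MulAut.conj Ψ f = f₁ := by rw [MulAut.conj_apply, hc, mul_inv_cancel_right]
  have hext : ∀ σ τ, IsExtension k Φ f σ τ →
      IsExtension k Φ f₁ (ψ * σ * ψ⁻¹) (Ψ * τ * Ψ⁻¹) := by
    intro σ τ hτ
    have hinv : ∀ j : ℤ, Ψ⁻¹.1 (vertex k j) = vertex k j := fun j => by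
      conv_lhs => rw [← hΨ j, inv_apply_self_circle]
    have hinva : ∀ i < k, ∀ t, Ψ⁻¹.1 ((f₁ ^ i).1 (arcMap k Φ t)) =
        (f ^ i).1 (arcMap k Φ (ψ⁻¹ t)) := fun i hi t => by
      conv_lhs => rw [← apply_inv_self_real ψ t, ← hΨa i hi, inv_apply_self_circle]
    refine ⟨fun j => ?_, fun i hi t => ?_⟩
    · rw [mul_apply_circle, mul_apply_circle, hinv, hτ.1, hΨ]
    · rw [mul_apply_circle, mul_apply_circle, hinva i hi, hτ.2 i hi, hΨa i hi, mul_apply_real,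
        mul_apply_real]
  refine ⟨Ψ, ?_⟩
  rw [circleGroup, circleGroup, MonoidHom.map_closure, image_union, image_singleton]
  congr 2
  · ext τ'
    constructor
    · rintro ⟨τ, ⟨σ, hσ, hτ⟩, rfl⟩
      exact ⟨_, ⟨σ, hσ, rfl⟩, hext σ τ hτ⟩
    · rintro ⟨_, ⟨σ, hσ, rfl⟩, hτ'⟩
      exact ⟨_, ⟨σ, hσ, isExtension_extHom hk Φ (rootSet_vertex hf) σ⟩,
        (hext σ _ (isExtension_extHom hk Φ (rootSet_vertex hf) σ)).unique hk
          (rootSet_vertex hf₁) hτ'⟩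
  · exact congrArg _ hconj

/-- The two factors commute, so the k-th power is the extension of g times that of h^k. This is the
source of the k-th powers in the affine action. -/
theorem mul_extHom_mem_rootSet (hk : 1 ≤ k) (hf : f ∈ rootSet k Φ g) (hc : Commute h g) :
    f * extHom hk Φ (rootSet_vertex hf) h ∈ rootSet k Φ (g * h ^ k) := by
  refine ⟨fun j => ?_, fun t => ?_⟩
  · have := (isExtension_extHom hk Φ (rootSet_vertex hf) h).1 j
    exact (congrArg f.1 this).trans (rootSet_vertex hf j)
  · rw [(commute_extHom hk hf hc).symm.mul_pow, pow_eq_extHom hk hf, ← map_pow, ← map_mul,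
      (isExtension_extHom hk Φ (rootSet_vertex hf) _).apply_arc hk]

/-- The extension of σ ∈ G along f commutes with the new root too, so it is also the extension along
that root: the generators other than the root are unchanged. -/
theorem circleGroup_mul_extHom (hk : 1 ≤ k) (hf : f ∈ rootSet k Φ g) (hh : h ∈ G)
    (hg : g ∈ G) (hG : ∀ σ ∈ G, ∀ τ ∈ G, Commute σ τ) :
    circleGroup G k Φ (f * extHom hk Φ (rootSet_vertex hf) h) = circleGroup G k Φ f := by
  have hf₁ := mul_extHom_mem_rootSet hk hf (hG h hh g hg)
  have hext : ∀ σ ∈ G, IsExtension k Φ (f * extHom hk Φ (rootSet_vertex hf) h) σ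
      (extHom hk Φ (rootSet_vertex hf) σ) := fun σ hσ => by
    have hσe := isExtension_extHom hk Φ (rootSet_vertex hf) σ
    exact isExtension_of_commute hσe.1 ((commute_extHom hk hf (hG σ hσ g hg)).mul_right
      ((hG σ hσ h hh).map (extHom hk Φ (rootSet_vertex hf)))) (hσe.apply_arc hk)
  apply le_antisymm
  · refine (Subgroup.closure_le _).2 (union_subset ?_ ?_)
    · rintro τ ⟨σ, hσ, hτ⟩
      rw [hτ.unique hk (rootSet_vertex hf₁) (hext σ hσ)]
      exact extHom_mem hk _ hσ
    · rintro _ rfl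
      exact mul_mem self_mem_circleGroup (extHom_mem hk _ hh)
  · refine (Subgroup.closure_le _).2 (union_subset ?_ ?_)
    · rintro τ ⟨σ, hσ, hτ⟩
      rw [hτ.eq_extHom hk (rootSet_vertex hf)]
      exact Subgroup.subset_closure (Or.inl ⟨σ, hσ, hext σ hσ⟩)
    · refine singleton_subset_iff.2 ?_
      have h1 : extHom hk Φ (rootSet_vertex hf) h ∈
          circleGroup G k Φ (f * extHom hk Φ (rootSet_vertex hf) h) :=
        Subgroup.subset_closure (Or.inl ⟨h, hh, hext h hh⟩)
      have := mul_mem (self_mem_circleGroup (G := G) (k := k) (Φ := Φ)) (inv_mem h1)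
      rwa [mul_inv_cancel_right] at this

/-- Pull the extension of `L 1` back by Ψ. The result has a fixed point, so it is an extension and
fixes every vertex; hence Ψ sends vertices to fixed points of the extension of `L 1`, which are
vertices. -/
theorem exists_vertex_of_conj (hk : 1 ≤ k) (hk' : 1 ≤ k') (hf : f ∈ rootSet k Φ g)
    (hf' : f' ∈ rootSet k' Φ' g') (hg : g ∈ G) (hG : ∀ σ ∈ G, ∀ τ ∈ G, Commute σ τ)
    (hL : L 1 ∈ G')
    (h : ∀ y ∈ circleGroup G' k' Φ' f', Ψ⁻¹ * y * Ψ ∈ circleGroup G k Φ f) (j : ℤ) :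
    ∃ l : ℤ, Ψ.1 (vertex k j) = vertex k' l := by
  have hΓ := h _ (extHom_mem hk' (rootSet_vertex hf') hL)
  have hfix := (isExtension_extHom hk' Φ' (rootSet_vertex hf') (L 1)).1
  obtain ⟨σ, -, e⟩ := exists_ext_of_fixed hk hf hg (fun σ hσ => hG σ hσ g hg) hΓ
    (z := Ψ⁻¹.1 (vertex k' 0)) (by
      rw [mul_apply_circle, mul_apply_circle, apply_inv_self_circle, hfix])
  have e2 := (isExtension_extHom hk Φ (rootSet_vertex hf) σ).1 j
  rw [← e, mul_apply_circle, mul_apply_circle] at e2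
  refine exists_vertex_of_fixed hk' (rootSet_vertex hf') (Φ := Φ') (σ := L 1)
    (fun t => by rw [L_apply]; linarith) ?_
  exact Ψ⁻¹.1.injective (by rw [e2, inv_apply_self_circle])

/-- The injective map Ψ embeds k distinct vertices into a set of k' vertices, counted through
residues. -/
theorem le_of_vertices_to_vertices (hk : 1 ≤ k) (hk' : 1 ≤ k')
    (h : ∀ j : ℤ, ∃ l : ℤ, Ψ.1 (vertex k j) = vertex k' l) : k ≤ k' := by
  choose l hl using h
  have hk0 : (0 : ℤ) < k' := by omega
  have := Finset.card_le_card_of_injOn (s := Finset.range k) (t := Finset.range k')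
    (fun i : ℕ => (l i % k').toNat) (fun i _ => by
      have := Int.emod_lt_of_pos (l i) hk0
      simp only [Finset.coe_range, mem_Iio]
      omega) (fun i hi j hj hij => by
      have h1 := Int.emod_nonneg (l i) hk0.ne'
      have h2 := Int.emod_nonneg (l j) hk0.ne'
      have h3 : l i % k' = l j % k' := by
        simp only at hij
        omega
      have h4 : vertex k' (l i) = vertex k' (l j) :=
        (vertex_eq_iff hk' _ _).2
          (Int.dvd_of_emod_eq_zero (Int.emod_eq_emod_iff_emod_sub_eq_zero.1 h3))
      rw [← hl, ← hl] at h4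
      obtain ⟨m, hm⟩ := (vertex_eq_iff hk _ _).1 (Ψ.1.injective h4)
      simp only [Finset.coe_range, mem_Iio] at hi hj
      have hk0 : (0 : ℤ) < k := by omega
      have hm1 : m < 1 := by
        by_contra hc
        nlinarith
      have hm2 : -1 < m := by
        by_contra hc
        nlinarith
      obtain rfl : m = 0 := by omega
      omega)
  simpa using this

/-- A conjugacy of the circle groups fixing the vertices comes from one of the line groups. -/
theorem exists_conjugator_of_fix_vertices (hk : 1 ≤ k) (hf : f ∈ rootSet k Φ g)
    (hf' : f' ∈ rootSet k Φ g') (hg : g ∈ G) (hg' : g' ∈ G')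
    (hG : ∀ σ ∈ G, ∀ τ ∈ G, Commute σ τ) (hG' : ∀ σ ∈ G', ∀ τ ∈ G', Commute σ τ)
    (h1 : ∀ y ∈ circleGroup G k Φ f, Ψ * y * Ψ⁻¹ ∈ circleGroup G' k Φ f')
    (h2 : ∀ y ∈ circleGroup G' k Φ f', Ψ⁻¹ * y * Ψ ∈ circleGroup G k Φ f)
    (hΨ : ∀ j : ℤ, Ψ.1 (vertex k j) = vertex k j) :
    ∃ ψ ∈ conjugators G' G, ∃ h ∈ G', ψ * g * ψ⁻¹ = g' * h ^ k := by
  obtain ⟨ψ, hψ⟩ := exists_restrict_arc hk Φ Ψ hΨ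
  have hinv : ∀ j : ℤ, Ψ⁻¹.1 (vertex k j) = vertex k j := fun j => by
    conv_lhs => rw [← hΨ j, inv_apply_self_circle]
  have hE := isExtension_extHom hk Φ (rootSet_vertex hf)
  have hE' := isExtension_extHom hk Φ (rootSet_vertex hf')
  have key : ∀ σ σ', extHom hk Φ (rootSet_vertex hf') σ' * Ψ =
      Ψ * extHom hk Φ (rootSet_vertex hf) σ → σ' * ψ = ψ * σ := fun σ σ' e => by
    ext t
    apply arcMap_injective hk (Φ := Φ)
    have : (extHom hk Φ (rootSet_vertex hf') σ').1 (Ψ.1 (arcMap k Φ t)) =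
        Ψ.1 ((extHom hk Φ (rootSet_vertex hf) σ).1 (arcMap k Φ t)) := by
      rw [← mul_apply_circle, e, mul_apply_circle]
    rwa [hψ, (hE' σ').apply_arc hk, (hE σ).apply_arc hk, hψ] at this
  refine ⟨ψ, mem_conjugators_iff.2 ⟨fun σ' hσ' => ?_, fun σ hσ => ?_⟩, ?_⟩
  · obtain ⟨σ, hσ, e⟩ := exists_ext_of_fixed hk hf hg (fun σ hσ => hG σ hσ g hg)
      (h2 _ (extHom_mem hk (rootSet_vertex hf') hσ')) (z := vertex k 0) (by
        rw [mul_apply_circle, mul_apply_circle, hΨ, (hE' σ').1, hinv])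
    exact ⟨σ, hσ, key _ _ (by rw [← e]; group)⟩
  · obtain ⟨σ', hσ', e⟩ := exists_ext_of_fixed hk hf' hg' (fun σ hσ => hG' σ hσ g' hg')
      (h1 _ (extHom_mem hk (rootSet_vertex hf) hσ)) (z := vertex k 0) (by
        rw [mul_apply_circle, mul_apply_circle, hinv, (hE σ).1, hΨ])
    exact ⟨σ', hσ', key _ _ (by rw [← e]; group)⟩
  · obtain ⟨h, hh, e⟩ := exists_mul_ext_of_shift_one hk hf' hg' (fun σ hσ => hG' σ hσ g' hg')
      (h1 _ self_mem_circleGroup) fun j => by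
        rw [mul_apply_circle, mul_apply_circle, hinv, rootSet_vertex hf, hΨ]
    refine ⟨h, hh, ?_⟩
    rw [mul_inv_eq_iff_eq_mul]
    refine (key _ _ ?_).symm
    -- Raising Ψ f Ψ⁻¹ = f' · (extension of h) to the power k leaves only extensions, which can be
    -- compared on the base arc.
    have e2 := congrArg (· ^ k) e
    simp only [conj_pow] at e2
    rw [(commute_extHom hk hf' (hG' h hh g' hg')).symm.mul_pow, pow_eq_extHom hk hf',
      pow_eq_extHom hk hf, ← map_pow, ← map_mul] at e2
    rw [← e2, inv_mul_cancel_right]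

theorem exists_conjugator_of_topConj (hk : 1 ≤ k) (hf : f ∈ rootSet k Φ g)
    (hf' : f' ∈ rootSet k Φ g') (hg : g ∈ G) (hg' : g' ∈ G')
    (hG : ∀ σ ∈ G, ∀ τ ∈ G, Commute σ τ) (hG' : ∀ σ ∈ G', ∀ τ ∈ G', Commute σ τ)
    (h1 : ∀ y ∈ circleGroup G k Φ f, Ψ * y * Ψ⁻¹ ∈ circleGroup G' k Φ f')
    (h2 : ∀ y ∈ circleGroup G' k Φ f', Ψ⁻¹ * y * Ψ ∈ circleGroup G k Φ f)
    (hv : ∀ j : ℤ, ∃ l : ℤ, Ψ.1 (vertex k j) = vertex k l)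
    (hv' : ∀ j : ℤ, ∃ l : ℤ, Ψ⁻¹.1 (vertex k j) = vertex k l) :
    ∃ ψ ∈ conjugators G' G, ∃ h ∈ G', ψ * g * ψ⁻¹ = g' * h ^ k := by
  obtain ⟨F, a, hF⟩ := exists_isShiftLift hk Ψ hv fun l => by
    obtain ⟨j, hj⟩ := hv' l
    exact ⟨j, by rw [← hj, apply_inv_self_circle]⟩
  obtain ⟨F', hF'⟩ := exists_isShiftLift_one hk (rootSet_vertex hf')
  -- Ψ shifts the vertices by a and f' by 1, so f'^(-a) Ψ fixes them; it conjugates the same two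
  -- groups because f' lies in the target.
  have hlift := (hF'.zpow (-a)).mul hF
  have hmem : f' ^ (-a) ∈ circleGroup G' k Φ f' := zpow_mem self_mem_circleGroup _
  refine exists_conjugator_of_fix_vertices (Ψ := f' ^ (-a) * Ψ) hk hf hf' hg hg' hG hG'
    (fun y hy => ?_) (fun y hy => ?_) fun j => ?_
  · have := mul_mem (mul_mem hmem (h1 y hy)) (inv_mem hmem)
    convert this using 1
    group
  · have := h2 _ (mul_mem (mul_mem (inv_mem hmem) hy) hmem)
    convert this using 1
    group
  · rw [hlift.apply_vertex]
    congr 1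
    ring

/-- Line groups which are conjugate compatibly with the parameters, up to a `k`-th power, give
conjugate circle groups. -/
theorem topConj_of_conjugator (hk : 1 ≤ k) (hf : f ∈ rootSet k Φ g)
    (hf' : f' ∈ rootSet k Φ g') (hg' : g' ∈ G')
    (hG' : ∀ σ ∈ G', ∀ τ ∈ G', Commute σ τ) (hψ : ψ ∈ conjugators G' G) (hh : h ∈ G')
    (e : ψ * g * ψ⁻¹ = g' * h ^ k) :
    TopConj (circleGroup G k Φ f) (circleGroup G' k Φ f') := by
  have hf₁ := mul_extHom_mem_rootSet hk hf' (hG' h hh g' hg')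
  rw [← circleGroup_mul_extHom hk hf' hh hg' hG', (show G' = _ from hψ)]
  rw [← e] at hf₁
  exact topConj_circleGroup_map hk hf hf₁

theorem topConj_circleGroup_lineGroup_iff
    (ℏ : ℝ ≃ₜ Set.Ioo (0 : ℝ) 1) (Φ : ℕ → (ℝ ≃o Set.Ioo (0 : ℝ) 1))
    {α α' : ℝ} (hα : Irrational α) {n n' k k' : ℕ} (hn : 2 ≤ n) (hn' : 2 ≤ n') (hk : 1 ≤ k)
    (hk' : 1 ≤ k') {g g' : HomeoPlusReal} (hg : g ∈ lineGroup ℏ α n)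
    (hg' : g' ∈ lineGroup ℏ α' n') {f f' : HomeoPlusCircle}
    (hf : f ∈ rootSet k (Φ k) g) (hf' : f' ∈ rootSet k' (Φ k') g') (ψ : HomeoPlusReal)
    (hψ : n = n' → MobiusEquiv α α' → ψ ∈ conjugators (lineGroup ℏ α n) (lineGroup ℏ α' n)) :
    TopConj (circleGroup (lineGroup ℏ α n) k (Φ k) f)
        (circleGroup (lineGroup ℏ α' n') k' (Φ k') f') ↔
      (n = n' ∧ k = k') ∧ MobiusEquiv α α' ∧
        ψ * g' * ψ⁻¹ ∈ affineOrbit (lineGroup ℏ α n) k g := by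
  have hG : ∀ σ ∈ lineGroup ℏ α n, ∀ τ ∈ lineGroup ℏ α n, Commute σ τ :=
    fun σ hσ τ hτ => lineGroup_commute hn hσ hτ
  have hG' : ∀ σ ∈ lineGroup ℏ α' n', ∀ τ ∈ lineGroup ℏ α' n', Commute σ τ :=
    fun σ hσ τ hτ => lineGroup_commute hn' hσ hτ
  constructor
  · rintro ⟨Ψ, hΨ⟩
    obtain ⟨h1, h2⟩ := map_conj_eq_iff.1 hΨ
    have hv := exists_vertex_of_conj hk hk' hf hf' hg hG (L_one_mem_lineGroup hn') h2
    have hv' := exists_vertex_of_conj (Ψ := Ψ⁻¹) hk' hk hf' hf hg' hG' (L_one_mem_lineGroup hn)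
      fun y hy => by rw [inv_inv]; exact h1 y hy
    obtain rfl : k = k' := le_antisymm (le_of_vertices_to_vertices hk hk' hv)
      (le_of_vertices_to_vertices hk' hk hv')
    obtain ⟨χ, hχ, h, hh, e⟩ :=
      exists_conjugator_of_topConj hk hf hf' hg hg' hG hG' h1 h2 hv hv'
    obtain ⟨rfl, hM⟩ := eq_and_mobiusEquiv_of_conjugators hn hn' hα (conjugators_inv hχ)
    have hψ := hψ rfl hM
    -- Conjugating χgχ⁻¹ = g'h^k by ψ and moving the k-th power across gives both witnesses.
    refine ⟨⟨rfl, rfl⟩, hM, ψ * χ, mem_lineNormalizer_iff.2 (conjugators_mul hψ hχ),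
      (ψ * h⁻¹ * ψ⁻¹) ^ k, ⟨_, ?_, rfl⟩, ?_⟩
    · have := (map_conj_eq_iff.1 (show _ = _ from hψ.symm)).1 _ (inv_mem hh)
      exact this
    · have : ψ * χ * g * (ψ * χ)⁻¹ = ψ * (χ * g * χ⁻¹) * ψ⁻¹ := by group
      rw [this, e, conj_pow, inv_pow]
      group
  · rintro ⟨⟨rfl, rfl⟩, hM, φ, hφ, _, ⟨u, hu, rfl⟩, e⟩
    have hψ := hψ rfl hM
    -- The orbit relation is solved for φgφ⁻¹ and carried back to the primed group by ψ⁻¹.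
    refine topConj_of_conjugator (ψ := ψ⁻¹ * φ) (h := ψ⁻¹ * u⁻¹ * ψ) hk hf hf' hg' hG'
      (conjugators_mul (conjugators_inv hψ) (mem_lineNormalizer_iff.1 hφ)) ?_ ?_
    · exact (map_conj_eq_iff.1 (show _ = _ from hψ.symm)).2 _ (inv_mem hu)
    · have e1 : φ * g * φ⁻¹ = ψ * g' * ψ⁻¹ * (u ^ k)⁻¹ := by rw [e, mul_inv_cancel_right]
      have e2 : ψ⁻¹ * φ * g * (ψ⁻¹ * φ)⁻¹ = ψ⁻¹ * (φ * g * φ⁻¹) * ψ := by group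
      have e3 : (ψ⁻¹ * u⁻¹ * ψ) ^ k = ψ⁻¹ * (u ^ k)⁻¹ * ψ := by
        have := conj_pow (i := k) (a := ψ⁻¹) (b := u⁻¹)
        rwa [inv_inv, inv_pow] at this
      rw [e2, e1, e3]
      group

end Conjugacy

end CircleZn

theorem theorem6p4
    (ℏ : ℝ ≃ₜ Set.Ioo (0 : ℝ) 1) (Φ : ℕ → (ℝ ≃o Set.Ioo (0 : ℝ) 1))
    (α α' : ℝ) (hα : Irrational α) (hα01 : α ∈ Set.Ioo (0 : ℝ) 1)
    (hα' : Irrational α') (hα01' : α' ∈ Set.Ioo (0 : ℝ) 1)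
    (n n' k k' : ℕ) (hn : 2 ≤ n) (hn' : 2 ≤ n') (hk : 1 ≤ k) (hk' : 1 ≤ k')
    (g g' : CircleZn.HomeoPlusReal)
    (hg : g ∈ CircleZn.admissible (CircleZn.lineGroup ℏ α n) k)
    (hg' : g' ∈ CircleZn.admissible (CircleZn.lineGroup ℏ α' n') k')
    (f f' : CircleZn.HomeoPlusCircle)
    (hf : f ∈ CircleZn.rootSet k (Φ k) g) (hf' : f' ∈ CircleZn.rootSet k' (Φ k') g') :
    -- the conjugators between the two line groups, among which `ψ` is fixed, exist
    (CircleZn.MobiusEquiv α α' →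
      (CircleZn.conjugators (CircleZn.lineGroup ℏ α n) (CircleZn.lineGroup ℏ α' n)).Nonempty) ∧
    -- the classification, for every choice of `ψ`
    (∀ ψ : CircleZn.HomeoPlusReal,
      (n = n' → CircleZn.MobiusEquiv α α' →
        ψ ∈ CircleZn.conjugators (CircleZn.lineGroup ℏ α n) (CircleZn.lineGroup ℏ α' n)) →
      (CircleZn.TopConj (CircleZn.circleGroup (CircleZn.lineGroup ℏ α n) k (Φ k) f)
          (CircleZn.circleGroup (CircleZn.lineGroup ℏ α' n') k' (Φ k') f') ↔
        (n = n' ∧ k = k') ∧ CircleZn.MobiusEquiv α α' ∧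
          ψ * g' * ψ⁻¹ ∈ CircleZn.affineOrbit (CircleZn.lineGroup ℏ α n) k g)) ∧
    -- independence of `f`
    (∀ f₁ ∈ CircleZn.rootSet k (Φ k) g,
      CircleZn.TopConj (CircleZn.circleGroup (CircleZn.lineGroup ℏ α n) k (Φ k) f)
        (CircleZn.circleGroup (CircleZn.lineGroup ℏ α n) k (Φ k) f₁)) := by
  refine ⟨CircleZn.conjugators_nonempty hn hα, fun ψ hψ =>
    CircleZn.topConj_circleGroup_lineGroup_iff ℏ Φ hα hn hn' hk hk' hg.1 hg'.1 hf hf' ψ hψ,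
    fun f₁ hf₁ => CircleZn.topConj_of_conjugator (ψ := 1) (h := 1) hk hf hf₁ hg.1
      (fun σ hσ τ hτ => CircleZn.lineGroup_commute hn hσ hτ)
      (CircleZn.mem_conjugators_self (one_mem _)) (one_mem _) (by simp)⟩
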